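/- Fix $k>0$ and let $\rho(r)=r^2/2$ for $|r|\le k$ and $\rho(r)=k|r|-k^2/2$ for $|r|>k$ be the Huber loss, with $\psi(r)=\rho'(r)=\max\{\min\{r,k\},-k\}$. Let $(\mathbf x,\epsilon),(\mathbf x_1,\epsilon_1),(\mathbf x_2,\epsilon_2),\dots$ be identically distributed random elements of $\mathbb R^p\times\mathbb R$, with $(\mathbf x_i,\epsilon_i)_{i\ge1}$ independent, and let $y_i=\mu^*+\mathbf x_i^{T}\beta^*+\epsilon_i$ for some $\mu^*\in\mathbb R$, $\beta^*\in\mathbb R^p$. Put $\mathbf w=(1,\mathbf x^{T})^{T}$. Assume that - $\mathbb E[\psi(\epsilon)\mid\mathbf x]=0$ ($\epsilon$ may depend on $\mathbf x$); - $\mathbb E\|\mathbf x\|^4<\infty$, and the covariance matrix $\Sigma_x^*$ of $\mathbf x$ is positive definite; write $\mu_x^*=\mathbb E[\mathbf x]$; - $\mathbb P(|\epsilon|=k)=0$ (so that $\psi'(\epsilon)$ exists almost surely), and the matrix $\mathbb E[\psi'(\epsilon)\mathbf w\mathbf w^{T}]$ is nonsingular. For each $n$ let $(\hat\mu_h,\hat\beta_h)$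 be a (measurable) minimizer of $\sum_{i=1}^n\rho(y_i-\mu-\mathbf x_i^{T}\beta)$ over $\mu\in\mathbb R$, $\beta\in\mathbb R^p$, and let $\bar{\mathbf x}=\frac1n\sum_{i=1}^n\mathbf x_i$ and $S_x=\frac1n\sum_{i=1}^n(\mathbf x_i-\bar{\mathbf x})(\mathbf x_i-\bar{\mathbf x})^{T}$. Let $\mathrm{vech}(M)\in\mathbb R^{p(p+1)/2}$ denote the vector of the lower triangular entries (diagonal included) of a symmetric $p\times p$ matrix $M$. Then, as $n\to\infty$, $$\sqrt n\begin{pmatrix}\hat\mu_h-\mu^*\\ \hat\beta_h-\beta^*\\ \mathrm{vech}(S_x)-\mathrm{vech}(\Sigma_x^*)\\ \bar{\mathbf x}-\mu_x^*\end{pmatrix}\xrightarrow{d}N\left(\mathbf 0,\ \mathbf U_1^{-1}\mathbf V_1\mathbf U_1^{-1}\right),$$ where $\mathbf U_1^{-1}\mathbf V_1\mathbf U_1^{-1}$ is positive semidefinite, $\mathbf U_1$ is the block diagonal matrix with diagonal blocks $$\mathbf U_{1,11}=\mathbb E[\psi'(\epsilon)\mathbf w\mathbf w^{T}],\quad \mathbf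 U_{1,22}=\mathbf I_{p(p+1)/2},\quad \mathbf U_{1,33}=\mathbf I_p,$$ and $\mathbf V_1=(\mathbf V_{1,ij})_{i,j=1,2,3}$ is the symmetric block matrix with $$\mathbf V_{1,11}=\mathbb E[\psi^2(\epsilon)\mathbf w\mathbf w^{T}],\quad \mathbf V_{1,22}=\mathrm{var}\big(\mathrm{vech}((\mathbf x-\mu_x^*)(\mathbf x-\mu_x^*)^{T})\big),\quad \mathbf V_{1,33}=\mathrm{var}(\mathbf x)=\Sigma_x^*,$$ $$\mathbf V_{1,23}=\mathbb E\big[\mathrm{vech}((\mathbf x-\mu_x^*)(\mathbf x-\mu_x^*)^{T})(\mathbf x-\mu_x^*)^{T}\big],\quad \mathbf V_{1,12}=0,\quad \mathbf V_{1,13}=0.$$ -/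

import Mathlib

open MeasureTheory ProbabilityTheory Filter Topology

noncomputable section

namespace HuberReg

/-- The Huber loss with tuning parameter `k`. -/
def rho (k r : ℝ) : ℝ := if |r| ≤ k then r ^ 2 / 2 else k * |r| - k ^ 2 / 2

/-- The Huber influence function: `r` truncated to `[-k, k]`. -/
def psi (k r : ℝ) : ℝ := max (min r k) (-k)

/-- Positions in the lower triangle (with diagonal) of a `p × p` matrix. -/
abbrev VechIdx (p : ℕ) : Type := {ij : Fin p × Fin p // ij.2 ≤ ij.1}

/-- Index set of the intercept and the slopes. -/
abbrev RegIdx (p : ℕ) : Type := Unit ⊕ Fin p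

/-- Index set of the joint parameter (intercept and slopes; `vech` of the covariance; mean). -/
abbrev ParamIdx (p : ℕ) : Type := RegIdx p ⊕ (VechIdx p ⊕ Fin p)

/-- Half-vectorization: the entries of the lower triangle. -/
def vech {p : ℕ} (M : Matrix (Fin p) (Fin p) ℝ) : VechIdx p → ℝ :=
  fun ij => M ij.1.1 ij.1.2

/-- The outer product `v vᵀ`. -/
def outer {ι : Type*} (v : ι → ℝ) : Matrix ι ι ℝ := Matrix.vecMulVec v v

/-- The regressor `w = (1, xᵀ)ᵀ`. -/
def design {p : ℕ} (x : EuclideanSpace ℝ (Fin p)) : RegIdx p → ℝ :=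
  Sum.elim (fun _ => 1) (fun j => x j)

/-- The joint vector `(m, bᵀ, vech(S)ᵀ, cᵀ)ᵀ`. -/
def joint {p : ℕ} (m : ℝ) (b : EuclideanSpace ℝ (Fin p)) (S : Matrix (Fin p) (Fin p) ℝ)
    (c : EuclideanSpace ℝ (Fin p)) : EuclideanSpace ℝ (ParamIdx p) :=
  WithLp.toLp 2 (Sum.elim (Sum.elim (fun _ => m) (fun j => b j))
    (Sum.elim (vech S) (fun j => c j)))

/-- The sum of Huber losses of the first `n` residuals, at intercept `m` and slope `b`. -/
def objective {p : ℕ} (k : ℝ) (n : ℕ) (y : ℕ → ℝ) (x : ℕ → EuclideanSpace ℝ (Fin p))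
    (m : ℝ) (b : EuclideanSpace ℝ (Fin p)) : ℝ :=
  ∑ i ∈ Finset.range n, rho k (y i - m - inner ℝ (x i) b)

/-- `(m, b)` is a Huber fit to the first `n` observations: a global minimizer of the
sum of Huber losses. -/
def IsHuberFit {p : ℕ} (k : ℝ) (n : ℕ) (y : ℕ → ℝ) (x : ℕ → EuclideanSpace ℝ (Fin p))
    (m : ℝ) (b : EuclideanSpace ℝ (Fin p)) : Prop :=
  ∀ (m' : ℝ) (b' : EuclideanSpace ℝ (Fin p)),
    objective k n y x m b ≤ objective k n y x m' b'

/-- The sample mean of the first `n` observations. -/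
def sampleMean {p : ℕ} (n : ℕ) (x : ℕ → EuclideanSpace ℝ (Fin p)) :
    EuclideanSpace ℝ (Fin p) :=
  (n : ℝ)⁻¹ • ∑ i ∈ Finset.range n, x i

/-- The sample covariance matrix of the first `n` observations (with divisor `n`). -/
def sampleCov {p : ℕ} (n : ℕ) (x : ℕ → EuclideanSpace ℝ (Fin p)) :
    Matrix (Fin p) (Fin p) ℝ :=
  (n : ℝ)⁻¹ • ∑ i ∈ Finset.range n, outer (fun j => (x i - sampleMean n x) j)

section Population

variable {Ω : Type*} [MeasurableSpace Ω]

/-- The covariance matrix of a random vector. -/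
def covMat {ι : Type*} (Y : Ω → ι → ℝ) (P : Measure Ω) : Matrix ι ι ℝ :=
  Matrix.of fun i j => cov[fun ω => Y ω i, fun ω => Y ω j; P]

/-- The population mean `μ_x` of `X`. -/
def muX {p : ℕ} (X : Ω → EuclideanSpace ℝ (Fin p)) (P : Measure Ω) :
    EuclideanSpace ℝ (Fin p) := ∫ ω, X ω ∂P

/-- The population covariance matrix `Σ_x` of `X`. -/
def SigmaX {p : ℕ} (X : Ω → EuclideanSpace ℝ (Fin p)) (P : Measure Ω) :
    Matrix (Fin p) (Fin p) ℝ := covMat (fun ω j => X ω j) P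

/-- `vech((X - μ_x)(X - μ_x)ᵀ)`. -/
def vechSq {p : ℕ} (X : Ω → EuclideanSpace ℝ (Fin p)) (P : Measure Ω) (ω : Ω) :
    VechIdx p → ℝ :=
  vech (outer fun j => (X ω - muX X P) j)

/-- The block `E[ψ'(ε) w wᵀ]`. -/
def U11 {p : ℕ} (k : ℝ) (X : Ω → EuclideanSpace ℝ (Fin p)) (e : Ω → ℝ) (P : Measure Ω) :
    Matrix (RegIdx p) (RegIdx p) ℝ :=
  Matrix.of fun a b => ∫ ω, deriv (psi k) (e ω) * outer (design (X ω)) a b ∂P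

/-- The block diagonal matrix with blocks `E[ψ'(ε) w wᵀ]`, `I` and `I`. -/
def U1 {p : ℕ} (k : ℝ) (X : Ω → EuclideanSpace ℝ (Fin p)) (e : Ω → ℝ) (P : Measure Ω) :
    Matrix (ParamIdx p) (ParamIdx p) ℝ :=
  Matrix.fromBlocks (U11 k X e P) 0 0 (Matrix.fromBlocks 1 0 0 1)

/-- The block `E[ψ(ε)² w wᵀ]`. -/
def V11 {p : ℕ} (k : ℝ) (X : Ω → EuclideanSpace ℝ (Fin p)) (e : Ω → ℝ) (P : Measure Ω) :
    Matrix (RegIdx p) (RegIdx p) ℝ :=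
  Matrix.of fun a b => ∫ ω, psi k (e ω) ^ 2 * outer (design (X ω)) a b ∂P

/-- The block `var(vech((X - μ_x)(X - μ_x)ᵀ))`. -/
def V22 {p : ℕ} (X : Ω → EuclideanSpace ℝ (Fin p)) (P : Measure Ω) :
    Matrix (VechIdx p) (VechIdx p) ℝ :=
  covMat (vechSq X P) P

/-- The block `E[vech((X - μ_x)(X - μ_x)ᵀ) (X - μ_x)ᵀ]`. -/
def V23 {p : ℕ} (X : Ω → EuclideanSpace ℝ (Fin p)) (P : Measure Ω) :
    Matrix (VechIdx p) (Fin p) ℝ :=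
  Matrix.of fun a j => ∫ ω, vechSq X P ω a * (X ω - muX X P) j ∂P

/-- The symmetric block matrix with vanishing `(1,2)` and `(1,3)` blocks. -/
def V1 {p : ℕ} (k : ℝ) (X : Ω → EuclideanSpace ℝ (Fin p)) (e : Ω → ℝ) (P : Measure Ω) :
    Matrix (ParamIdx p) (ParamIdx p) ℝ :=
  Matrix.fromBlocks (V11 k X e P) 0 0
    (Matrix.fromBlocks (V22 X P) (V23 X P) (V23 X P).transpose (SigmaX X P))

end Population

end HuberReg

end

/-!
The Huber loss agrees with its second-order Taylor polynomial as long as the segment of residuals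
does not cross one of the kinks `±k`. Since `P(|ε| = k) = 0`, the observations that cross a kink
under a perturbation of order `1/√n` of the coefficients contribute negligibly, so on every ball the
rescaled objective is uniformly close in probability to a quadratic with Hessian `U₁₁`. Both being
convex, their minimizers are close as well (Hjort and Pollard), which gives
`√n (θ̂ - θ*) = U₁₁⁻¹ n^(-1/2) ∑ ψ(εᵢ) wᵢ + o_P(1)`. Centering at the sample mean instead of `μ_x`
changes `√n S_x` only by a product of two bounded-in-probability normalized sums divided by `√n`.
Hence the whole vector is `U₁⁻¹` times a normalized sum of i.i.d. scores plus `o_P(1)`, and the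
central limit theorem applies; the scores have covariance `V₁`, whose blocks `(1,2)` and `(1,3)`
vanish because `E[ψ(ε) | x] = 0`.
-/

namespace HuberReg

open scoped Matrix

section Loss

variable {k r : ℝ}

lemma psi_of_abs_le (h : |r| ≤ k) : psi k r = r := by
  rw [psi, min_eq_left (abs_le.1 h).2, max_eq_left (abs_le.1 h).1]

lemma psi_of_le (hk : 0 < k) (h : k ≤ r) : psi k r = k := by
  rw [psi, min_eq_right h, max_eq_left (by linarith)]

lemma psi_of_le_neg (hk : 0 < k) (h : r ≤ -k) : psi k r = -k := by
  rw [psi, min_eq_left (by linarith), max_eq_right h]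

lemma abs_psi_le (hk : 0 < k) (r : ℝ) : |psi k r| ≤ k :=
  abs_le.2 ⟨le_max_right _ _, max_le (min_le_right _ _) (by linarith)⟩

lemma continuous_psi : Continuous (psi k) := by
  unfold psi
  fun_prop

lemma measurable_psi : Measurable (psi k) := continuous_psi.measurable

/-- At the kinks `±k`, where `psi k` is not differentiable, `deriv` is the junk value `0`. -/
lemma deriv_psi (hk : 0 < k) (r : ℝ) : deriv (psi k) r = if |r| < k then 1 else 0 := by
  split_ifs with h
  · have hloc : psi k =ᶠ[𝓝 r] id := by
      filter_upwards [continuous_abs.continuousAt.eventually_lt continuousAt_const h] with b hb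
      exact psi_of_abs_le hb.le
    rw [hloc.deriv_eq, deriv_id]
  · rcases le_abs'.1 (not_lt.1 h) with hr | hr
    · refine IsLocalMin.deriv_eq_zero (.of_forall fun b => ?_)
      rw [psi_of_le_neg hk hr]
      exact (abs_le.1 (abs_psi_le hk b)).1
    · refine IsLocalMax.deriv_eq_zero (.of_forall fun b => ?_)
      rw [psi_of_le hk hr]
      exact (abs_le.1 (abs_psi_le hk b)).2

lemma deriv_psi_mem (hk : 0 < k) (r : ℝ) : deriv (psi k) r = 0 ∨ deriv (psi k) r = 1 := by
  rw [deriv_psi hk]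
  exact (ite_eq_or_eq _ _ _).symm

lemma sub_psi_mul_sub_psi_nonpos {s : ℝ} (hs : |s| ≤ k) (r : ℝ) :
    (s - psi k r) * (r - psi k r) ≤ 0 := by
  obtain ⟨hs₁, hs₂⟩ := abs_le.1 hs
  have hk : -k ≤ k := hs₁.trans hs₂
  rcases le_total r k with h | h
  · rcases le_total (-k) r with h' | h'
    · simp [psi, h, h']
    · rw [psi, min_eq_left h, max_eq_right h']
      exact mul_nonpos_of_nonneg_of_nonpos (by linarith) (by linarith)
  · rw [psi, min_eq_right h, max_eq_left hk]
    exact mul_nonpos_of_nonpos_of_nonneg (by linarith) (by linarith)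

lemma rho_eq_psi_mul_sub (hk : 0 < k) (r : ℝ) : rho k r = psi k r * r - psi k r ^ 2 / 2 := by
  rw [rho]
  split_ifs with h
  · rw [psi_of_abs_le h]
    ring
  · rcases lt_abs.1 (not_le.1 h) with hr | hr
    · rw [psi_of_le hk hr.le, abs_of_pos (hk.trans hr)]
    · rw [psi_of_le_neg hk (by linarith), abs_of_neg (by linarith)]
      ring

lemma mul_sub_sq_le_rho (hk : 0 < k) {s : ℝ} (hs : |s| ≤ k) (r : ℝ) :
    s * r - s ^ 2 / 2 ≤ rho k r := by
  rw [rho_eq_psi_mul_sub hk]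
  nlinarith [sub_psi_mul_sub_psi_nonpos hs r, sq_nonneg (s - psi k r)]

lemma rho_add_psi_mul_le (hk : 0 < k) (a b : ℝ) : rho k a + psi k a * (b - a) ≤ rho k b := by
  rw [rho_eq_psi_mul_sub hk a]
  linarith [mul_sub_sq_le_rho hk (abs_psi_le hk a) b]

lemma rho_le_add_psi_mul_add_sq (hk : 0 < k) (a b : ℝ) :
    rho k b ≤ rho k a + psi k a * (b - a) + (b - a) ^ 2 / 2 := by
  rw [rho_eq_psi_mul_sub hk a, rho_eq_psi_mul_sub hk b]
  nlinarith [sub_psi_mul_sub_psi_nonpos (abs_psi_le hk b) a,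
    sq_nonneg (b - a - (psi k b - psi k a))]

lemma convexOn_rho (hk : 0 < k) : ConvexOn ℝ Set.univ (rho k) := by
  refine ⟨convex_univ, fun x _ y _ a b ha hb hab => ?_⟩
  simp only [smul_eq_mul]
  have hx := mul_le_mul_of_nonneg_left (rho_add_psi_mul_le hk (a * x + b * y) x) ha
  have hy := mul_le_mul_of_nonneg_left (rho_add_psi_mul_le hk (a * x + b * y) y) hb
  obtain rfl : b = 1 - a := by linarith
  linarith

lemma psi_sub_eq_of_abs_lt (hk : 0 < k) {a h : ℝ} (hh : |h| < |(|a| - k)|) :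
    psi k (a - h) = psi k a - deriv (psi k) a * h := by
  have hl := neg_abs_le h
  have hu := le_abs_self h
  rw [deriv_psi hk]
  split_ifs with ha
  · rw [abs_of_neg (sub_neg.2 ha)] at hh
    rw [psi_of_abs_le ha.le, psi_of_abs_le ((abs_sub a h).trans (by linarith)), one_mul]
  · rw [abs_of_nonneg (sub_nonneg.2 (not_lt.1 ha))] at hh
    rcases le_abs'.1 (not_lt.1 ha) with hak | hak
    · rw [abs_of_neg (a := a) (by linarith)] at hh
      rw [psi_of_le_neg hk hak, psi_of_le_neg hk (by linarith), zero_mul, sub_zero]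
    · rw [abs_of_pos (a := a) (by linarith)] at hh
      rw [psi_of_le hk hak, psi_of_le hk (by linarith), zero_mul, sub_zero]

lemma rho_sub_eq_of_abs_lt (hk : 0 < k) {a h : ℝ} (hh : |h| < |(|a| - k)|) :
    rho k (a - h) = rho k a - psi k a * h + deriv (psi k) a * (h ^ 2 / 2) := by
  rw [rho_eq_psi_mul_sub hk, rho_eq_psi_mul_sub hk, psi_sub_eq_of_abs_lt hk hh, deriv_psi hk]
  split_ifs with ha
  · rw [psi_of_abs_le ha.le]
    ring
  · ring

lemma abs_rho_sub_expansion_le (hk : 0 < k) (a h : ℝ) :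
    |rho k (a - h) - rho k a + psi k a * h - deriv (psi k) a * (h ^ 2 / 2)|
      ≤ if |(|a| - k)| ≤ |h| then h ^ 2 else 0 := by
  split_ifs with hh
  · have hlow := rho_add_psi_mul_le hk a (a - h)
    have hupp := rho_le_add_psi_mul_add_sq hk a (a - h)
    rw [abs_le]
    rcases deriv_psi_mem hk a with hd | hd <;> rw [hd] <;> constructor <;> linarith [sq_nonneg h]
  · rw [rho_sub_eq_of_abs_lt hk (not_le.1 hh)]
    ring_nf
    exact abs_zero.le

end Loss

section InMeasure

variable {Ω : Type*} [MeasurableSpace Ω] {P : Measure Ω} {α : Type*} {l : Filter α}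
  {E F : Type*} [NormedAddCommGroup E] [NormedAddCommGroup F]

lemma tendstoInMeasure_zero_iff {f : α → Ω → E} :
    TendstoInMeasure P f l (fun _ => 0) ↔
      ∀ δ, 0 < δ → Tendsto (fun n => P {ω | δ ≤ ‖f n ω‖}) l (𝓝 0) := by
  simp only [tendstoInMeasure_iff_norm, sub_zero]

lemma tendstoInMeasure_zero_of_norm_le {f : α → Ω → E} {g : α → Ω → F}
    (hg : TendstoInMeasure P g l fun _ => 0) (hfg : ∀ᶠ n in l, ∀ᵐ ω ∂P, ‖f n ω‖ ≤ ‖g n ω‖) :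
    TendstoInMeasure P f l fun _ => 0 := by
  rw [tendstoInMeasure_zero_iff] at hg ⊢
  intro δ hδ
  refine tendsto_of_tendsto_of_tendsto_of_le_of_le' tendsto_const_nhds (hg δ hδ)
    (.of_forall fun _ => zero_le) ?_
  filter_upwards [hfg] with n hn
  refine measure_mono_ae ?_
  filter_upwards [hn] with ω hω hδω using le_trans hδω hω

lemma tendstoInMeasure_zero_of_continuousAt {ι : Type*} [Finite ι] {f : ι → α → Ω → E}
    {φ : (ι → E) → F} (hφ : ContinuousAt φ 0) (hφ₀ : φ 0 = 0)
    (hf : ∀ i, TendstoInMeasure P (f i) l fun _ => 0) :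
    TendstoInMeasure P (fun n ω => φ fun i => f i n ω) l fun _ => 0 := by
  have := Fintype.ofFinite ι
  simp only [tendstoInMeasure_zero_iff] at hf ⊢
  intro δ hδ
  obtain ⟨η, hη, hφη⟩ := Metric.continuousAt_iff.1 hφ δ hδ
  simp only [dist_zero_right, hφ₀] at hφη
  have hsum : Tendsto (fun n => ∑ i, P {ω | η ≤ ‖f i n ω‖}) l (𝓝 0) := by
    simpa using tendsto_finsetSum Finset.univ fun i _ => hf i η hη
  refine tendsto_of_tendsto_of_tendsto_of_le_of_le tendsto_const_nhds hsum (fun _ => zero_le)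
    fun n => (measure_mono fun ω hω => ?_).trans (measure_iUnion_fintype_le P _)
  by_contra hω'
  simp only [Set.mem_iUnion, Set.mem_ofPred_eq, not_exists, not_le] at hω'
  exact hω.not_gt (hφη ((pi_norm_lt_iff hη).2 hω'))

lemma tendstoInMeasure_zero_add {f g : α → Ω → E} (hf : TendstoInMeasure P f l fun _ => 0)
    (hg : TendstoInMeasure P g l fun _ => 0) :
    TendstoInMeasure P (fun n ω => f n ω + g n ω) l fun _ => 0 :=
  tendstoInMeasure_zero_of_continuousAt (f := ![f, g]) (φ := fun v => v 0 + v 1)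
    (by fun_prop) (add_zero 0) (Fin.forall_fin_two.2 ⟨hf, hg⟩)

lemma tendstoInMeasure_zero_const_smul [NormedSpace ℝ E] (c : ℝ) {f : α → Ω → E}
    (hf : TendstoInMeasure P f l fun _ => 0) :
    TendstoInMeasure P (fun n ω => c • f n ω) l fun _ => 0 :=
  tendstoInMeasure_zero_of_continuousAt (f := fun _ : Unit => f) (φ := fun v => c • v ())
    ((continuous_apply ()).const_smul c).continuousAt (smul_zero c) fun _ => hf

lemma tendstoInMeasure_zero_of_coord {ι : Type*} [Fintype ι] {f : α → Ω → EuclideanSpace ℝ ι}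
    (hf : ∀ i, TendstoInMeasure P (fun n ω => f n ω i) l fun _ => 0) :
    TendstoInMeasure P f l fun _ => 0 :=
  tendstoInMeasure_zero_of_continuousAt (φ := WithLp.toLp 2)
    (PiLp.continuous_toLp 2 _).continuousAt (WithLp.toLp_zero 2) hf

lemma tendstoInMeasure_zero_of_tendsto_integral {f : α → Ω → E} (hf : ∀ n, Integrable (f n) P)
    (h : Tendsto (fun n => ∫ ω, ‖f n ω‖ ∂P) l (𝓝 0)) : TendstoInMeasure P f l fun _ => 0 := by
  refine tendstoInMeasure_of_tendsto_eLpNorm one_ne_zero (fun n => (hf n).aestronglyMeasurable)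
    aestronglyMeasurable_const ?_
  have hnorm (n : α) : eLpNorm (f n - fun _ => 0) 1 P = ENNReal.ofReal (∫ ω, ‖f n ω‖ ∂P) := by
    rw [show (f n - fun _ => 0) = f n from sub_zero _, eLpNorm_one_eq_lintegral_enorm,
      ofReal_integral_norm_eq_lintegral_enorm (hf n)]
  simpa only [hnorm, ENNReal.ofReal_zero] using ENNReal.tendsto_ofReal h

/-- Boundedness in probability, `Zₙ = O_P(1)`, uniformly over the whole family. -/
def BoundedInMeasure (P : Measure Ω) (Z : α → Ω → E) : Prop :=
  ∀ η > 0, ∃ M : ℝ, ∀ n, P {ω | M ≤ ‖Z n ω‖} ≤ η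

lemma boundedInMeasure_of_integral_sq_le [IsFiniteMeasure P] {Z : α → Ω → E} {C : ℝ}
    (hint : ∀ n, Integrable (fun ω => ‖Z n ω‖ ^ 2) P) (hC : ∀ n, ∫ ω, ‖Z n ω‖ ^ 2 ∂P ≤ C) :
    BoundedInMeasure P Z := by
  intro η hη
  have hlim : Tendsto (fun M : ℝ => ENNReal.ofReal (C / M)) atTop (𝓝 0) := by
    simpa using ENNReal.tendsto_ofReal (tendsto_const_nhds (x := C) |>.div_atTop tendsto_id)
  obtain ⟨M, hMη, hM⟩ := ((hlim.eventually_lt_const hη).and (eventually_ge_atTop 1)).exists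
  refine ⟨M, fun n => le_trans ?_ hMη.le⟩
  have hmarkov : M * P.real {ω | M ≤ ‖Z n ω‖ ^ 2} ≤ C :=
    (mul_meas_ge_le_integral_of_nonneg (.of_forall fun _ => sq_nonneg _) (hint n) M).trans (hC n)
  calc P {ω | M ≤ ‖Z n ω‖}
      ≤ P {ω | M ≤ ‖Z n ω‖ ^ 2} := measure_mono fun ω (hω : M ≤ ‖Z n ω‖) =>
        hω.trans (le_self_pow₀ (hM.trans hω) two_ne_zero)
    _ = ENNReal.ofReal (P.real {ω | M ≤ ‖Z n ω‖ ^ 2}) := by simp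
    _ ≤ ENNReal.ofReal (C / M) :=
        ENNReal.ofReal_le_ofReal ((le_div_iff₀' (one_pos.trans_le hM)).2 hmarkov)

lemma BoundedInMeasure.tendstoInMeasure_smul [NormedSpace ℝ E] {Z : α → Ω → E}
    (hZ : BoundedInMeasure P Z) {a : α → ℝ} (ha : Tendsto a l (𝓝 0)) :
    TendstoInMeasure P (fun n ω => a n • Z n ω) l fun _ => 0 := by
  refine tendstoInMeasure_zero_iff.2 fun δ hδ => ENNReal.tendsto_nhds_zero.2 fun η hη => ?_
  obtain ⟨M, hM⟩ := hZ η hη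
  have hlim : Tendsto (fun n => ‖a n‖ * M) l (𝓝 0) := by simpa using ha.norm.mul_const M
  filter_upwards [hlim.eventually_lt_const hδ] with n hn
  refine (measure_mono fun ω (hω : δ ≤ ‖a n • Z n ω‖) => ?_).trans (hM n)
  rw [norm_smul] at hω
  exact (lt_of_mul_lt_mul_left (hn.trans_le hω) (norm_nonneg _)).le

lemma BoundedInMeasure.continuousLinearMap_comp [NormedSpace ℝ E] [NormedSpace ℝ F]
    {Z : α → Ω → E} (hZ : BoundedInMeasure P Z) (L : E →L[ℝ] F) :
    BoundedInMeasure P fun n ω => L (Z n ω) := by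
  intro η hη
  obtain ⟨M, hM⟩ := hZ η hη
  refine ⟨(‖L‖ + 1) * M, fun n => (measure_mono fun ω hω => ?_).trans (hM n)⟩
  refine le_of_mul_le_mul_left (le_trans hω ?_) (by positivity : 0 < ‖L‖ + 1)
  exact (L.le_opNorm _).trans (by gcongr; linarith)

lemma BoundedInMeasure.mul {Y Z : α → Ω → ℝ} (hY : BoundedInMeasure P Y)
    (hZ : BoundedInMeasure P Z) : BoundedInMeasure P fun n ω => Y n ω * Z n ω := by
  intro η hη
  obtain ⟨M, hM⟩ := hY (η / 2) (ENNReal.half_pos hη.ne')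
  obtain ⟨N, hN⟩ := hZ (η / 2) (ENNReal.half_pos hη.ne')
  refine ⟨M * N, fun n => ?_⟩
  calc P {ω | M * N ≤ ‖Y n ω * Z n ω‖}
      ≤ P ({ω | M ≤ ‖Y n ω‖} ∪ {ω | N ≤ ‖Z n ω‖}) := measure_mono fun ω hω => by
        by_contra! hlt
        simp only [Set.mem_union, Set.mem_ofPred_eq, not_or, not_le, norm_mul] at hlt hω
        exact hω.not_gt (mul_lt_mul'' hlt.1 hlt.2 (norm_nonneg _) (norm_nonneg _))
    _ ≤ η / 2 + η / 2 := (measure_union_le _ _).trans (add_le_add (hM n) (hN n))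
    _ = η := ENNReal.add_halves η

end InMeasure

section NormalizedSum

variable {Ω : Type*} {E : Type*} [NormedAddCommGroup E] [NormedSpace ℝ E]

/-- The normalized sum `n^{-1/2} ∑_{i < n} Zᵢ` of the central limit theorem. -/
noncomputable def rootSum (Z : ℕ → Ω → E) (n : ℕ) (ω : Ω) : E :=
  (√(n : ℝ))⁻¹ • ∑ i ∈ Finset.range n, Z i ω

lemma inv_sqrt_natCast_sq (n : ℕ) : (√(n : ℝ))⁻¹ ^ 2 = (n : ℝ)⁻¹ := by
  rw [inv_pow, Real.sq_sqrt n.cast_nonneg]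

lemma sqrt_natCast_mul_inv (n : ℕ) : √(n : ℝ) * (n : ℝ)⁻¹ = (√(n : ℝ))⁻¹ := by
  rw [← div_eq_mul_inv, Real.sqrt_div_self', one_div]

lemma sqrt_smul_average_sub (Z : ℕ → Ω → E) (c : E) (n : ℕ) (ω : Ω) :
    √(n : ℝ) • ((n : ℝ)⁻¹ • ∑ i ∈ Finset.range n, Z i ω - c)
      = rootSum (fun i ω => Z i ω - c) n ω := by
  have hc : √(n : ℝ) • c = (√(n : ℝ))⁻¹ • (n : ℝ) • c := by
    rw [smul_smul, inv_mul_eq_div, Real.div_sqrt]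
  rw [rootSum, smul_sub, smul_smul, sqrt_natCast_mul_inv, Finset.sum_sub_distrib, Finset.sum_const,
    Finset.card_range, smul_sub, hc, Nat.cast_smul_eq_nsmul]

lemma ofLp_rootSum {ι : Type*} [Fintype ι] (Z : ℕ → Ω → EuclideanSpace ℝ ι) (n : ℕ) (ω : Ω)
    (a : ι) : rootSum Z n ω a = rootSum (fun i ω => Z i ω a) n ω := by
  simp [rootSum]

lemma average_mul_sub_average (u v : ℕ → ℝ) (a b : ℝ) (n : ℕ) :
    (n : ℝ)⁻¹ * ∑ i ∈ Finset.range n, (u i - (n : ℝ)⁻¹ * ∑ j ∈ Finset.range n, u j) *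
        (v i - (n : ℝ)⁻¹ * ∑ j ∈ Finset.range n, v j)
      = (n : ℝ)⁻¹ * ∑ i ∈ Finset.range n, (u i - a) * (v i - b) -
        (n : ℝ)⁻¹ ^ 2 * ((∑ i ∈ Finset.range n, (u i - a)) * ∑ i ∈ Finset.range n, (v i - b)) := by
  rcases eq_or_ne (n : ℝ) 0 with hn | hn
  · simp [hn]
  · simp only [sub_mul, mul_sub, Finset.sum_sub_distrib, ← Finset.sum_mul, ← Finset.mul_sum,
      Finset.sum_const, Finset.card_range, nsmul_eq_mul]
    field_simp
    ring

lemma sqrt_mul_average_mul_sub_average_sub (u v : ℕ → Ω → ℝ) (a b s : ℝ) (n : ℕ) (ω : Ω) :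
    √(n : ℝ) * ((n : ℝ)⁻¹ * ∑ i ∈ Finset.range n,
        (u i ω - (n : ℝ)⁻¹ * ∑ j ∈ Finset.range n, u j ω) *
        (v i ω - (n : ℝ)⁻¹ * ∑ j ∈ Finset.range n, v j ω) - s)
      = rootSum (fun i ω => (u i ω - a) * (v i ω - b) - s) n ω -
        (√(n : ℝ))⁻¹ *
          (rootSum (fun i ω => u i ω - a) n ω * rootSum (fun i ω => v i ω - b) n ω) := by
  rw [average_mul_sub_average _ _ a b, ← sqrt_smul_average_sub]
  simp only [rootSum, smul_eq_mul]
  linear_combination (-(n : ℝ)⁻¹ * (∑ i ∈ Finset.range n, (u i ω - a)) *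
    ∑ i ∈ Finset.range n, (v i ω - b)) * sqrt_natCast_mul_inv n + (√(n : ℝ))⁻¹ *
    (∑ i ∈ Finset.range n, (u i ω - a)) * (∑ i ∈ Finset.range n, (v i ω - b)) *
    inv_sqrt_natCast_sq n

variable [MeasurableSpace Ω] {P : Measure Ω}

lemma tendstoInMeasure_average_array {Z : ℕ → ℕ → Ω → E} {m : ℕ → ℝ}
    (hint : ∀ n i, Integrable (Z n i) P) (hm : ∀ n i, ∫ ω, ‖Z n i ω‖ ∂P ≤ m n)
    (hlim : Tendsto m atTop (𝓝 0)) :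
    TendstoInMeasure P (fun (n : ℕ) ω => (n : ℝ)⁻¹ • ∑ i ∈ Finset.range n, Z n i ω)
      atTop fun _ => 0 := by
  refine tendstoInMeasure_zero_of_tendsto_integral
    (fun n => (integrable_finsetSum _ fun i _ => hint n i).smul _) ?_
  refine squeeze_zero' (.of_forall fun n => integral_nonneg fun _ => norm_nonneg _) ?_ hlim
  filter_upwards [eventually_gt_atTop 0] with n hn
  calc ∫ ω, ‖(n : ℝ)⁻¹ • ∑ i ∈ Finset.range n, Z n i ω‖ ∂P
      ≤ ∫ ω, (n : ℝ)⁻¹ * ∑ i ∈ Finset.range n, ‖Z n i ω‖ ∂P := by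
        refine integral_mono ((integrable_finsetSum _ fun i _ => hint n i).smul _).norm
          ((integrable_finsetSum _ fun i _ => (hint n i).norm).const_mul _) fun ω => ?_
        simp only [norm_smul, norm_inv, RCLike.norm_natCast]
        gcongr
        exact norm_sum_le _ _
    _ = (n : ℝ)⁻¹ * ∑ i ∈ Finset.range n, ∫ ω, ‖Z n i ω‖ ∂P := by
        rw [integral_const_mul, integral_finsetSum _ fun i _ => (hint n i).norm]
    _ ≤ (n : ℝ)⁻¹ * (n * m n) := by
        gcongr
        simpa using Finset.sum_le_card_nsmul _ _ _ fun i (_ : i ∈ Finset.range n) => hm n i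
    _ = m n := inv_mul_cancel_left₀ (by positivity) _

lemma tendstoInMeasure_average_sub_integral [CompleteSpace E] [MeasurableSpace E] [BorelSpace E]
    [IsFiniteMeasure P] {Z : ℕ → Ω → E} {Z₀ : Ω → E} (hindep : Pairwise fun i j => Z i ⟂ᵢ[P] Z j)
    (hident : ∀ i, IdentDistrib (Z i) Z₀ P P) (hint : Integrable Z₀ P) :
    TendstoInMeasure P
      (fun (n : ℕ) ω => (n : ℝ)⁻¹ • ∑ i ∈ Finset.range n, Z i ω - ∫ ω, Z₀ ω ∂P)
      atTop fun _ => 0 := by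
  have hZ (i : ℕ) : Integrable (Z i) P := (hident i).integrable_iff.2 hint
  refine tendstoInMeasure_of_tendsto_ae (fun n => ?_) ?_
  · exact (((integrable_finsetSum _ fun i _ => hZ i).smul _).sub
      (integrable_const _)).aestronglyMeasurable
  · filter_upwards [strong_law_ae Z (hZ 0) hindep fun i => (hident i).trans (hident 0).symm]
      with ω hω
    rw [(hident 0).integral_eq] at hω
    simpa using hω.sub_const (∫ ω, Z₀ ω ∂P)

lemma memLp_rootSum {Z : ℕ → Ω → E} {q : ENNReal} (hZ : ∀ i, MemLp (Z i) q P) (n : ℕ) :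
    MemLp (rootSum Z n) q P :=
  (memLp_finsetSum _ fun i _ => hZ i).const_smul _

lemma integral_rootSum_sq_le [IsFiniteMeasure P] {Z : ℕ → Ω → ℝ} {Z₀ : Ω → ℝ}
    (hindep : Pairwise fun i j => Z i ⟂ᵢ[P] Z j) (hident : ∀ i, IdentDistrib (Z i) Z₀ P P)
    (h2 : MemLp Z₀ 2 P) (h0 : ∫ ω, Z₀ ω ∂P = 0) (n : ℕ) :
    ∫ ω, rootSum Z n ω ^ 2 ∂P ≤ ∫ ω, Z₀ ω ^ 2 ∂P := by
  have hZ (i : ℕ) : MemLp (Z i) 2 P := (hident i).memLp_iff.2 h2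
  have hmean : ∫ ω, rootSum Z n ω ∂P = 0 := by
    simp only [rootSum]
    rw [integral_smul, integral_finsetSum _ fun i _ => (hZ i).integrable one_le_two]
    simp [(hident _).integral_eq, h0]
  have hvar : Var[rootSum Z n; P] = (n : ℝ)⁻¹ * (n * ∫ ω, Z₀ ω ^ 2 ∂P) := by
    have hsum : rootSum Z n = (√(n : ℝ))⁻¹ • ∑ i ∈ Finset.range n, Z i := by
      ext ω
      simp [rootSum]
    rw [hsum, variance_smul, inv_sqrt_natCast_sq,
      IndepFun.variance_sum (fun i _ => hZ i) fun i _ j _ hij => hindep hij]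
    simp [(hident _).variance_eq, variance_of_integral_eq_zero h2.aestronglyMeasurable.aemeasurable
      h0]
  rw [← variance_of_integral_eq_zero
    (memLp_rootSum hZ n).aestronglyMeasurable.aemeasurable hmean, hvar]
  rcases n.eq_zero_or_pos with rfl | hn
  · simpa using integral_nonneg fun ω => sq_nonneg (Z₀ ω)
  · rw [inv_mul_cancel_left₀ (by positivity)]

lemma boundedInMeasure_rootSum [IsFiniteMeasure P] {Z : ℕ → Ω → ℝ} {Z₀ : Ω → ℝ}
    (hindep : Pairwise fun i j => Z i ⟂ᵢ[P] Z j) (hident : ∀ i, IdentDistrib (Z i) Z₀ P P)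
    (h2 : MemLp Z₀ 2 P) (h0 : ∫ ω, Z₀ ω ∂P = 0) : BoundedInMeasure P (rootSum Z) := by
  refine boundedInMeasure_of_integral_sq_le (C := ∫ ω, Z₀ ω ^ 2 ∂P) (fun n => ?_) fun n => ?_
  · exact (memLp_rootSum (fun i => (hident i).memLp_iff.2 h2) n).norm.integrable_sq
  · simpa only [Real.norm_eq_abs, sq_abs] using integral_rootSum_sq_le hindep hident h2 h0 n

lemma boundedInMeasure_rootSum_euclideanSpace [IsFiniteMeasure P] {ι : Type*} [Fintype ι]
    {Z : ℕ → Ω → EuclideanSpace ℝ ι} {Z₀ : Ω → EuclideanSpace ℝ ι}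
    (hindep : Pairwise fun i j => Z i ⟂ᵢ[P] Z j) (hident : ∀ i, IdentDistrib (Z i) Z₀ P P)
    (h2 : MemLp Z₀ 2 P) (h0 : ∫ ω, Z₀ ω ∂P = 0) : BoundedInMeasure P (rootSum Z) := by
  have hL2 (n : ℕ) : MemLp (rootSum Z n) 2 P :=
    memLp_rootSum (fun i => (hident i).memLp_iff.2 h2) n
  have hcoord (a : ι) : Measurable fun z : EuclideanSpace ℝ ι => z a := by fun_prop
  refine boundedInMeasure_of_integral_sq_le (C := ∑ a, ∫ ω, Z₀ ω a ^ 2 ∂P)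
    (fun n => (hL2 n).norm.integrable_sq) fun n => ?_
  simp only [EuclideanSpace.real_norm_sq_eq]
  rw [integral_finsetSum _ fun a _ => ((hL2 n).eval_piLp a).integrable_sq]
  refine Finset.sum_le_sum fun a _ => ?_
  simp only [ofLp_rootSum]
  refine integral_rootSum_sq_le (fun i j hij => (hindep hij).comp (hcoord a) (hcoord a))
    (fun i => (hident i).comp (hcoord a)) (h2.eval_piLp a) ?_ n
  simp only [Function.comp_apply]
  rw [← eval_integral_piLp fun b => (h2.eval_piLp b).integrable one_le_two, h0, PiLp.zero_apply]

end NormalizedSum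

section CovarianceMatrix

variable {Ω : Type*} [MeasurableSpace Ω] {P : Measure Ω} [IsFiniteMeasure P]
  {ι κ : Type*} [Fintype ι] {Y : Ω → ι → ℝ}

lemma covariance_dotProduct (h2 : ∀ a, MemLp (fun ω => Y ω a) 2 P) (s t : ι → ℝ) :
    cov[fun ω => s ⬝ᵥ Y ω, fun ω => t ⬝ᵥ Y ω; P] = s ⬝ᵥ covMat Y P *ᵥ t := by
  simp only [dotProduct, Matrix.mulVec, covMat, Matrix.of_apply]
  rw [covariance_fun_sum_fun_sum (fun a => (h2 a).const_mul (s a)) fun b => (h2 b).const_mul (t b)]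
  simp only [covariance_const_mul_left, covariance_const_mul_right, Finset.mul_sum]
  exact Finset.sum_congr rfl fun a _ => Finset.sum_congr rfl fun b _ => by ring

lemma posSemidef_covMat [Finite κ] {Y : Ω → κ → ℝ} (h2 : ∀ a, MemLp (fun ω => Y ω a) 2 P) :
    (covMat Y P).PosSemidef := by
  cases nonempty_fintype κ
  refine Matrix.PosSemidef.of_dotProduct_mulVec_nonneg ?_ fun t => ?_
  · ext a b
    exact covariance_comm _ _
  · rw [star_trivial, ← covariance_dotProduct h2, covariance_self]
    · exact variance_nonneg _ _
    · exact (memLp_finsetSum _ fun a _ => (h2 a).const_mul (t a)).aestronglyMeasurable.aemeasurable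

lemma covMat_mulVec (h2 : ∀ a, MemLp (fun ω => Y ω a) 2 P) (A : Matrix κ ι ℝ) :
    covMat (fun ω => A *ᵥ Y ω) P = A * covMat Y P * Aᵀ := by
  ext i j
  rw [Matrix.mul_assoc, Matrix.mul_apply]
  exact covariance_dotProduct h2 (A i) (A j)

lemma variance_inner {Z : Ω → EuclideanSpace ℝ ι} (h2 : MemLp Z 2 P) (t : EuclideanSpace ℝ ι) :
    Var[fun ω => inner ℝ (Z ω) t; P] = t ⬝ᵥ covMat (fun ω a => Z ω a) P *ᵥ t := by
  rw [← covariance_dotProduct h2.eval_piLp]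
  exact (covariance_self (h2.inner_const t).aestronglyMeasurable.aemeasurable).symm

end CovarianceMatrix

section CentralLimitTheorem

variable {Ω : Type*} [MeasurableSpace Ω] {P : Measure Ω}

lemma tendsto_charFun_map_rootSum [IsProbabilityMeasure P] {Z : ℕ → Ω → ℝ} {Z₀ : Ω → ℝ}
    (hindep : iIndepFun Z P) (hident : ∀ i, IdentDistrib (Z i) Z₀ P P) (h2 : MemLp Z₀ 2 P)
    (h0 : ∫ ω, Z₀ ω ∂P = 0) :
    Tendsto (fun n => charFun (P.map (rootSum Z n)) 1) atTop
      (𝓝 (Complex.exp (-((Var[Z₀; P] : ℂ) / 2)))) := by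
  have hclt := tendstoInDistribution_inv_sqrt_mul_sum_sub (Y := id)
    (P' := gaussianReal 0 Var[Z 0; P].toNNReal) HasLaw.id ((hident 0).memLp_iff.2 h2) hindep
    fun i => (hident i).trans (hident 0).symm
  have hchar := ProbabilityMeasure.tendsto_iff_tendsto_charFun.1 hclt.tendsto 1
  simp only [ProbabilityMeasure.coe_mk, Measure.map_id, charFun_gaussianReal,
    (hident 0).variance_eq, (hident 0).integral_eq, h0, mul_zero, sub_zero,
    Real.coe_toNNReal _ (variance_nonneg Z₀ P)] at hchar
  convert hchar using 2
  · rfl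
  · simp

lemma charFun_map_eq_charFun_map_inner {E : Type*} [NormedAddCommGroup E] [InnerProductSpace ℝ E]
    [MeasurableSpace E] [OpensMeasurableSpace E] [SecondCountableTopology E] {Y : Ω → E}
    (hY : AEMeasurable Y P) (t : E) :
    charFun (P.map Y) t = charFun (P.map fun ω => inner ℝ (Y ω) t) 1 := by
  rw [charFun_apply, charFun_apply, integral_map hY (by fun_prop),
    integral_map (by fun_prop) (by fun_prop)]
  simp

theorem tendstoInDistribution_rootSum [IsProbabilityMeasure P] {ι : Type*} [Fintype ι]
    [DecidableEq ι] {Z : ℕ → Ω → EuclideanSpace ℝ ι} {Z₀ : Ω → EuclideanSpace ℝ ι}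
    (hindep : iIndepFun Z P) (hident : ∀ i, IdentDistrib (Z i) Z₀ P P) (h2 : MemLp Z₀ 2 P)
    (h0 : ∫ ω, Z₀ ω ∂P = 0) :
    TendstoInDistribution (rootSum Z) atTop (id : EuclideanSpace ℝ ι → EuclideanSpace ℝ ι)
      (fun _ => P) (multivariateGaussian 0 (covMat (fun ω a => Z₀ ω a) P)) := by
  have hcoord := h2.eval_piLp
  have hmeas (n : ℕ) : AEMeasurable (rootSum Z n) P :=
    (memLp_rootSum (fun i => (hident i).memLp_iff.2 h2) n).aestronglyMeasurable.aemeasurable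
  refine ⟨hmeas, aemeasurable_id, ProbabilityMeasure.tendsto_iff_tendsto_charFun.2 fun t => ?_⟩
  have hinner : Measurable fun z : EuclideanSpace ℝ ι => inner ℝ z t := by fun_prop
  have hmean : ∫ ω, inner ℝ (Z₀ ω) t ∂P = 0 := by
    simp only [real_inner_comm t]
    rw [integral_inner (h2.integrable one_le_two), h0, inner_zero_right]
  have hlim := tendsto_charFun_map_rootSum (hindep.comp (fun _ z => inner ℝ z t) fun _ => hinner)
    (fun i => (hident i).comp hinner) (h2.inner_const t) hmean
  simp only [ProbabilityMeasure.coe_mk, Measure.map_id, charFun_multivariateGaussian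
    (posSemidef_covMat hcoord)]
  convert hlim using 2
  · rw [charFun_map_eq_charFun_map_inner (hmeas _)]
    congr 2
    ext ω
    simp [rootSum, inner_smul_left, sum_inner]
  · rw [← variance_inner h2, inner_zero_right, Complex.ofReal_zero, zero_mul, zero_sub]
    rfl

end CentralLimitTheorem

section ConvexArgmin

variable {E : Type*} [NormedAddCommGroup E] [NormedSpace ℝ E]

lemma norm_sub_lt_of_convexOn_of_close {A q : E → ℝ} {T t₀ : E} {R M c δ : ℝ}
    (hA : ConvexOn ℝ Set.univ A) (hT : ∀ t, A T ≤ A t)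
    (hclose : ∀ t, ‖t‖ ≤ M → |A t - q t| ≤ R) (hq : ∀ t, q t₀ + c * ‖t - t₀‖ ^ 2 ≤ q t)
    (hδ : 0 < δ) (hM : ‖t₀‖ + δ ≤ M) (hR : 2 * R < c * δ ^ 2) : ‖T - t₀‖ < δ := by
  by_contra! hfar
  have hpos : 0 < ‖T - t₀‖ := hδ.trans_le hfar
  -- The point of the segment from `t₀` to `T` at distance `δ` from `t₀` stays in the ball where
  -- `A` is close to `q`, however far away `T` is.
  set τ := δ / ‖T - t₀‖
  have hτ0 : 0 ≤ τ := by positivity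
  have hτ1 : τ ≤ 1 := (div_le_one hpos).2 hfar
  set s := (1 - τ) • t₀ + τ • T
  have hs : s - t₀ = τ • (T - t₀) := by simp only [s]; module
  have hs_norm : ‖s - t₀‖ = δ := by
    rw [hs, norm_smul, Real.norm_of_nonneg hτ0, div_mul_cancel₀ _ hpos.ne']
  have hs_mem : ‖s‖ ≤ M := by
    linarith [norm_le_norm_add_norm_sub' s t₀]
  have hA_le : A s ≤ A t₀ := by
    have hconv := hA.2 (Set.mem_univ t₀) (Set.mem_univ T) (sub_nonneg.2 hτ1) hτ0 (by ring)
    simp only [smul_eq_mul] at hconv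
    nlinarith [hT t₀]
  have hs_close := abs_le.1 (hclose s hs_mem)
  have ht₀_close := abs_le.1 (hclose t₀ (by linarith))
  have hgrowth := hq s
  rw [hs_norm] at hgrowth
  linarith [hs_close.1, ht₀_close.2]

theorem tendstoInMeasure_argmin_sub_of_convexOn {Ω : Type*} [MeasurableSpace Ω] {P : Measure Ω}
    {α : Type*} {l : Filter α} {A q : α → Ω → E → ℝ} {T t₀ : α → Ω → E} {R : ℝ → α → Ω → ℝ}
    {c : ℝ} (hc : 0 < c) (hA : ∀ n ω, ConvexOn ℝ Set.univ (A n ω))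
    (hT : ∀ᶠ n in l, ∀ᵐ ω ∂P, ∀ t, A n ω (T n ω) ≤ A n ω t)
    (hq : ∀ n ω t, q n ω (t₀ n ω) + c * ‖t - t₀ n ω‖ ^ 2 ≤ q n ω t)
    (hclose : ∀ M, ∀ᶠ n in l, ∀ ω t, ‖t‖ ≤ M → |A n ω t - q n ω t| ≤ R M n ω)
    (hR : ∀ M, TendstoInMeasure P (R M) l fun _ => 0) (ht₀ : BoundedInMeasure P t₀) :
    TendstoInMeasure P (fun n ω => T n ω - t₀ n ω) l fun _ => 0 := by
  refine tendstoInMeasure_zero_iff.2 fun δ hδ => ENNReal.tendsto_nhds_zero.2 fun η hη => ?_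
  obtain ⟨M, hM⟩ := ht₀ (η / 2) (ENNReal.half_pos hη.ne')
  have hR_small := ENNReal.tendsto_nhds_zero.1
    (tendstoInMeasure_zero_iff.1 (hR (M + δ)) (c * δ ^ 2 / 4) (by positivity))
    (η / 2) (ENNReal.half_pos hη.ne')
  filter_upwards [hR_small, hT, hclose (M + δ)] with n hRn hTn hclose_n
  have hcover : ∀ᵐ ω ∂P, δ ≤ ‖T n ω - t₀ n ω‖ →
      M ≤ ‖t₀ n ω‖ ∨ c * δ ^ 2 / 4 ≤ ‖R (M + δ) n ω‖ := by
    filter_upwards [hTn] with ω hTω hfar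
    by_contra! hlt
    refine hfar.not_gt (norm_sub_lt_of_convexOn_of_close (hA n ω) hTω (hclose_n ω) (hq n ω) hδ
      (by linarith) ?_)
    linarith [(Real.le_norm_self _).trans_lt hlt.2, mul_pos hc (sq_pos_of_pos hδ)]
  calc P {ω | δ ≤ ‖T n ω - t₀ n ω‖}
      ≤ P ({ω | M ≤ ‖t₀ n ω‖} ∪ {ω | c * δ ^ 2 / 4 ≤ ‖R (M + δ) n ω‖}) := measure_mono_ae hcover
    _ ≤ η / 2 + η / 2 := (measure_union_le _ _).trans (add_le_add (hM n) hRn)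
    _ = η := ENNReal.add_halves η

end ConvexArgmin

section QuadraticForm

variable {ι : Type*} [Fintype ι]

lemma exists_pos_mul_norm_sq_le_of_posDef {U : Matrix ι ι ℝ} (hU : U.PosDef) :
    ∃ c > 0, ∀ t : EuclideanSpace ℝ ι, c * ‖t‖ ^ 2 ≤ t ⬝ᵥ U *ᵥ t := by
  have hcont : Continuous fun t : EuclideanSpace ℝ ι => t ⬝ᵥ U *ᵥ t := by
    simp only [dotProduct, Matrix.mulVec]
    fun_prop
  have hsphere {t : EuclideanSpace ℝ ι} (ht : t ≠ 0) : ‖t‖⁻¹ • t ∈ Metric.sphere 0 1 := by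
    simp [norm_smul, ht]
  rcases subsingleton_or_nontrivial (EuclideanSpace ℝ ι) with _ | _
  · exact ⟨1, one_pos, fun t => by simp [Subsingleton.elim t 0]⟩
  obtain ⟨t₀, ht₀, hmin⟩ := (isCompact_sphere (0 : EuclideanSpace ℝ ι) 1).exists_isMinOn
    (NormedSpace.sphere_nonempty.2 zero_le_one) hcont.continuousOn
  have ht₀_ne : (t₀ : ι → ℝ) ≠ 0 := fun h =>
    ne_zero_of_mem_unit_sphere ⟨t₀, ht₀⟩ ((WithLp.ofLp_eq_zero 2).1 h)
  refine ⟨t₀ ⬝ᵥ U *ᵥ t₀, by simpa using hU.dotProduct_mulVec_pos ht₀_ne, fun t => ?_⟩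
  rcases eq_or_ne t 0 with rfl | ht
  · simp
  have : 0 < ‖t‖ := norm_pos_iff.2 ht
  have hle : t₀ ⬝ᵥ U *ᵥ t₀ ≤ ‖t‖⁻¹ * (‖t‖⁻¹ * (t ⬝ᵥ U *ᵥ t)) := by
    simpa only [Set.mem_ofPred_eq, WithLp.ofLp_smul, Matrix.mulVec_smul, smul_dotProduct,
      dotProduct_smul, smul_eq_mul] using hmin (hsphere ht)
  calc _ ≤ ‖t‖⁻¹ * (‖t‖⁻¹ * (t ⬝ᵥ U *ᵥ t)) * ‖t‖ ^ 2 := by gcongr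
    _ = t ⬝ᵥ U *ᵥ t := by field_simp

lemma quadratic_eq_add_of_mulVec_eq {U : Matrix ι ι ℝ} (hU : U.IsSymm) {z t₀ : ι → ℝ}
    (hz : U *ᵥ t₀ = z) (t : ι → ℝ) :
    t ⬝ᵥ U *ᵥ t / 2 - z ⬝ᵥ t =
      t₀ ⬝ᵥ U *ᵥ t₀ / 2 - z ⬝ᵥ t₀ + (t - t₀) ⬝ᵥ U *ᵥ (t - t₀) / 2 := by
  have hcross : t₀ ⬝ᵥ U *ᵥ t = z ⬝ᵥ t := by
    rw [Matrix.dotProduct_mulVec, ← Matrix.mulVec_transpose, hU.eq, hz]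
  simp only [Matrix.mulVec_sub, dotProduct_sub, sub_dotProduct, hz, hcross, dotProduct_comm _ z]
  ring

lemma abs_dotProduct_mulVec_le (G : Matrix ι ι ℝ) (t : EuclideanSpace ℝ ι) :
    |t ⬝ᵥ G *ᵥ t| ≤ (∑ a, ∑ b, |G a b|) * ‖t‖ ^ 2 := by
  simp only [dotProduct, Matrix.mulVec, Finset.mul_sum, Finset.sum_mul]
  refine (Finset.abs_sum_le_sum_abs _ _).trans (Finset.sum_le_sum fun a _ =>
    (Finset.abs_sum_le_sum_abs _ _).trans (Finset.sum_le_sum fun b _ => ?_))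
  calc |t a * (G a b * t b)| = |G a b| * (‖t a‖ * ‖t b‖) := by
        simp only [abs_mul, Real.norm_eq_abs]
        ring
    _ ≤ |G a b| * (‖t‖ * ‖t‖) := by gcongr <;> exact PiLp.norm_apply_le t _
    _ = |G a b| * ‖t‖ ^ 2 := by rw [sq]

lemma dotProduct_outer_mulVec (w t : EuclideanSpace ℝ ι) :
    t ⬝ᵥ outer w *ᵥ t = inner ℝ w t ^ 2 := by
  rw [outer, Matrix.vecMulVec_mulVec, EuclideanSpace.inner_eq_star_dotProduct]
  simp [dotProduct_comm _ (t : ι → ℝ), sq]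

end QuadraticForm

section Expansion

variable {ι : Type*} [Fintype ι] {k M : ℝ} {n : ℕ}

/-- The sum of Huber losses at the local parameter `t`, that is at `θ = t / √n`, normalized to
vanish at `t = 0`. -/
noncomputable def localObjective (k : ℝ) (n : ℕ) (w : ℕ → EuclideanSpace ℝ ι) (r : ℕ → ℝ)
    (t : EuclideanSpace ℝ ι) : ℝ :=
  ∑ i ∈ Finset.range n, (rho k (r i - inner ℝ (w i) ((√(n : ℝ))⁻¹ • t)) - rho k (r i))

/-- The empirical version `n⁻¹ ∑ ψ'(rᵢ) wᵢ wᵢᵀ` of the Hessian of the expected Huber loss. -/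
noncomputable def empiricalHessian (k : ℝ) (n : ℕ) (w : ℕ → EuclideanSpace ℝ ι) (r : ℕ → ℝ) :
    Matrix ι ι ℝ :=
  (n : ℝ)⁻¹ • ∑ i ∈ Finset.range n, deriv (psi k) (r i) • outer (w i)

/-- The squared length `‖w‖²` if the residual `r` lies within `M ‖w‖ / √n` of a kink `±k`, and `0`
otherwise. Only such observations can cross a kink when the local parameter ranges over the ball
of radius `M`. -/
noncomputable def kinkMass (k M : ℝ) (n : ℕ) (w : EuclideanSpace ℝ ι) (r : ℝ) : ℝ :=
  if |(|r| - k)| ≤ M * ‖w‖ / √(n : ℝ) then ‖w‖ ^ 2 else 0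

lemma kinkMass_nonneg (w : EuclideanSpace ℝ ι) (r : ℝ) : 0 ≤ kinkMass k M n w r := by
  unfold kinkMass
  positivity

lemma kinkMass_le (w : EuclideanSpace ℝ ι) (r : ℝ) : kinkMass k M n w r ≤ ‖w‖ ^ 2 := by
  unfold kinkMass
  split_ifs
  exacts [le_rfl, sq_nonneg _]

lemma measurable_kinkMass : Measurable fun d : EuclideanSpace ℝ ι × ℝ => kinkMass k M n d.1 d.2 :=
  Measurable.ite (measurableSet_le (by fun_prop) (by fun_prop)) (by fun_prop) measurable_const

lemma convexOn_localObjective (hk : 0 < k) (n : ℕ) (w : ℕ → EuclideanSpace ℝ ι) (r : ℕ → ℝ) :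
    ConvexOn ℝ Set.univ (localObjective k n w r) := by
  refine ⟨convex_univ, fun s _ t _ a b ha hb hab => ?_⟩
  simp only [localObjective, smul_eq_mul, Finset.mul_sum, ← Finset.sum_add_distrib]
  refine Finset.sum_le_sum fun i _ => ?_
  have hconv := (convexOn_rho hk).2 (Set.mem_univ (r i - inner ℝ (w i) ((√(n : ℝ))⁻¹ • s)))
    (Set.mem_univ (r i - inner ℝ (w i) ((√(n : ℝ))⁻¹ • t))) ha hb hab
  have haffine : r i - inner ℝ (w i) ((√(n : ℝ))⁻¹ • (a • s + b • t)) =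
      a • (r i - inner ℝ (w i) ((√(n : ℝ))⁻¹ • s)) +
        b • (r i - inner ℝ (w i) ((√(n : ℝ))⁻¹ • t)) := by
    simp only [inner_smul_right, inner_add_right, smul_eq_mul]
    linear_combination (-r i) * hab
  rw [haffine]
  simp only [smul_eq_mul] at hconv ⊢
  linear_combination hconv + rho k (r i) * hab

lemma dotProduct_empiricalHessian_mulVec (w : ℕ → EuclideanSpace ℝ ι) (r : ℕ → ℝ)
    (t : EuclideanSpace ℝ ι) :
    t ⬝ᵥ empiricalHessian k n w r *ᵥ t =
      ∑ i ∈ Finset.range n, deriv (psi k) (r i) * inner ℝ (w i) ((√(n : ℝ))⁻¹ • t) ^ 2 := by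
  simp only [empiricalHessian, Matrix.smul_mulVec, Matrix.sum_mulVec, dotProduct_smul,
    dotProduct_sum, dotProduct_outer_mulVec, inner_smul_right, mul_pow, inv_sqrt_natCast_sq,
    smul_eq_mul, Finset.mul_sum, mul_left_comm]

lemma rootScore_dotProduct (w : ℕ → EuclideanSpace ℝ ι) (r : ℕ → ℝ) (t : EuclideanSpace ℝ ι) :
    ((√(n : ℝ))⁻¹ • ∑ i ∈ Finset.range n, psi k (r i) • w i) ⬝ᵥ t =
      ∑ i ∈ Finset.range n, psi k (r i) * inner ℝ (w i) ((√(n : ℝ))⁻¹ • t) := by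
  have hinner (v : EuclideanSpace ℝ ι) : v ⬝ᵥ t = inner ℝ v t := by
    simp [EuclideanSpace.inner_eq_star_dotProduct, dotProduct_comm]
  simp only [hinner, real_inner_smul_left, real_inner_smul_right, sum_inner, Finset.mul_sum,
    mul_left_comm]

lemma abs_rho_sub_expansion_le_kinkMass (hk : 0 < k) (w : EuclideanSpace ℝ ι) (r : ℝ)
    {t : EuclideanSpace ℝ ι} (ht : ‖t‖ ≤ M) {h : ℝ} (hh : h = inner ℝ w ((√(n : ℝ))⁻¹ • t)) :
    |rho k (r - h) - rho k r + psi k r * h - deriv (psi k) r * (h ^ 2 / 2)| ≤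
      M ^ 2 * (n : ℝ)⁻¹ * kinkMass k M n w r := by
  have : 0 ≤ M := (norm_nonneg t).trans ht
  have hh_le : |h| ≤ M * ‖w‖ / √(n : ℝ) := by
    calc |h| ≤ ‖w‖ * ‖(√(n : ℝ))⁻¹ • t‖ := hh ▸ abs_real_inner_le_norm _ _
      _ = ‖t‖ * ‖w‖ / √(n : ℝ) := by
        rw [norm_smul, Real.norm_of_nonneg (by positivity)]
        ring
      _ ≤ M * ‖w‖ / √(n : ℝ) := by gcongr
  refine (abs_rho_sub_expansion_le hk r h).trans ?_
  split_ifs with hkink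
  · rw [kinkMass, if_pos (hkink.trans hh_le)]
    calc h ^ 2 = |h| ^ 2 := (sq_abs h).symm
      _ ≤ (M * ‖w‖ / √(n : ℝ)) ^ 2 := by gcongr
      _ = M ^ 2 * (n : ℝ)⁻¹ * ‖w‖ ^ 2 := by
        rw [div_eq_mul_inv, mul_pow, inv_sqrt_natCast_sq]
        ring
  · exact mul_nonneg (by positivity) (kinkMass_nonneg w r)

lemma abs_localObjective_sub_quadratic_le (hk : 0 < k) (w : ℕ → EuclideanSpace ℝ ι) (r : ℕ → ℝ)
    (U : Matrix ι ι ℝ) {t : EuclideanSpace ℝ ι} (ht : ‖t‖ ≤ M) :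
    |localObjective k n w r t - (t ⬝ᵥ U *ᵥ t / 2 -
        ((√(n : ℝ))⁻¹ • ∑ i ∈ Finset.range n, psi k (r i) • w i) ⬝ᵥ t)| ≤
      M ^ 2 * ((n : ℝ)⁻¹ * ∑ i ∈ Finset.range n, kinkMass k M n (w i) (r i) +
        ∑ a, ∑ b, |(empiricalHessian k n w r - U) a b|) := by
  have hsplit : localObjective k n w r t - (t ⬝ᵥ U *ᵥ t / 2 -
        ((√(n : ℝ))⁻¹ • ∑ i ∈ Finset.range n, psi k (r i) • w i) ⬝ᵥ t) =
      ∑ i ∈ Finset.range n, (rho k (r i - inner ℝ (w i) ((√(n : ℝ))⁻¹ • t)) - rho k (r i) +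
        psi k (r i) * inner ℝ (w i) ((√(n : ℝ))⁻¹ • t) -
        deriv (psi k) (r i) * (inner ℝ (w i) ((√(n : ℝ))⁻¹ • t) ^ 2 / 2)) +
      t ⬝ᵥ (empiricalHessian k n w r - U) *ᵥ t / 2 := by
    rw [rootScore_dotProduct, Matrix.sub_mulVec, dotProduct_sub,
      dotProduct_empiricalHessian_mulVec, sub_div, Finset.sum_div, localObjective,
      Finset.sum_sub_distrib (f := fun i => _ + _), Finset.sum_add_distrib]
    simp only [mul_div_assoc]
    ring
  rw [hsplit, mul_add]
  refine (abs_add_le _ _).trans (add_le_add ?_ ?_)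
  · rw [← mul_assoc, Finset.mul_sum]
    exact (Finset.abs_sum_le_sum_abs _ _).trans
      (Finset.sum_le_sum fun i _ => abs_rho_sub_expansion_le_kinkMass hk (w i) (r i) ht rfl)
  · rw [abs_div, abs_two, mul_comm]
    calc _ ≤ |t ⬝ᵥ (empiricalHessian k n w r - U) *ᵥ t| := half_le_self (abs_nonneg _)
      _ ≤ (∑ a, ∑ b, |(empiricalHessian k n w r - U) a b|) * ‖t‖ ^ 2 :=
        abs_dotProduct_mulVec_le _ t
      _ ≤ _ := by gcongr

end Expansion

section Linearization

variable {Ω : Type*} [MeasurableSpace Ω] {P : Measure Ω} {ι : Type*} [Fintype ι] {k : ℝ}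
  {W : ℕ → Ω → EuclideanSpace ℝ ι} {W₀ : Ω → EuclideanSpace ℝ ι} {r : ℕ → Ω → ℝ} {r₀ : Ω → ℝ}

lemma tendsto_integral_kinkMass (hW₀ : MemLp W₀ 2 P) (hr₀ : AEMeasurable r₀ P)
    (hatom : ∀ᵐ ω ∂P, |r₀ ω| ≠ k) (M : ℝ) :
    Tendsto (fun n : ℕ => ∫ ω, kinkMass k M n (W₀ ω) (r₀ ω) ∂P) atTop (𝓝 0) := by
  rw [← integral_zero Ω ℝ]
  refine tendsto_integral_of_dominated_convergence (fun ω => ‖W₀ ω‖ ^ 2) (fun n => ?_)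
    hW₀.norm.integrable_sq (fun n => .of_forall fun ω => ?_) ?_
  · exact (measurable_kinkMass.comp_aemeasurable
      (hW₀.aestronglyMeasurable.aemeasurable.prodMk hr₀)).aestronglyMeasurable
  · rw [Real.norm_of_nonneg (kinkMass_nonneg _ _)]
    exact kinkMass_le _ _
  · filter_upwards [hatom] with ω hω
    have hdist : 0 < |(|r₀ ω| - k)| := abs_pos.2 (sub_ne_zero.2 hω)
    have hlim : Tendsto (fun n : ℕ => M * ‖W₀ ω‖ / √(n : ℝ)) atTop (𝓝 0) :=
      tendsto_const_nhds.div_atTop (Real.tendsto_sqrt_atTop.comp tendsto_natCast_atTop_atTop)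
    refine tendsto_const_nhds.congr' ?_
    filter_upwards [hlim.eventually_lt_const hdist] with n hn
    rw [kinkMass, if_neg hn.not_ge]

lemma tendstoInMeasure_average_kinkMass
    (hident : ∀ i, IdentDistrib (fun ω => (W i ω, r i ω)) (fun ω => (W₀ ω, r₀ ω)) P P)
    (hW₀ : MemLp W₀ 2 P) (hatom : ∀ᵐ ω ∂P, |r₀ ω| ≠ k) (M : ℝ) :
    TendstoInMeasure P
      (fun (n : ℕ) ω => (n : ℝ)⁻¹ * ∑ i ∈ Finset.range n, kinkMass k M n (W i ω) (r i ω))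
      atTop fun _ => 0 := by
  have hpair := (hident 0).aemeasurable_snd
  have hkink (n i : ℕ) : IdentDistrib (fun ω => kinkMass k M n (W i ω) (r i ω))
      (fun ω => kinkMass k M n (W₀ ω) (r₀ ω)) P P := (hident i).comp measurable_kinkMass
  have hint (n : ℕ) : Integrable (fun ω => kinkMass k M n (W₀ ω) (r₀ ω)) P :=
    hW₀.norm.integrable_sq.mono' (measurable_kinkMass.comp_aemeasurable hpair).aestronglyMeasurable
      (.of_forall fun ω => (Real.norm_of_nonneg (kinkMass_nonneg _ _)).trans_le (kinkMass_le _ _))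
  refine tendstoInMeasure_average_array (fun n i => (hkink n i).integrable_iff.2 (hint n))
    (fun n i => ?_) (tendsto_integral_kinkMass hW₀ (measurable_snd.comp_aemeasurable hpair) hatom M)
  simp only [Real.norm_of_nonneg (kinkMass_nonneg _ _)]
  exact (hkink n i).integral_eq.le

lemma tendstoInMeasure_empiricalHessian_sub [IsFiniteMeasure P] (hk : 0 < k)
    (hindep : Pairwise fun i j => (fun ω => (W i ω, r i ω)) ⟂ᵢ[P] fun ω => (W j ω, r j ω))
    (hident : ∀ i, IdentDistrib (fun ω => (W i ω, r i ω)) (fun ω => (W₀ ω, r₀ ω)) P P)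
    (hW₀ : MemLp W₀ 2 P) (a b : ι) :
    TendstoInMeasure P
      (fun n ω => empiricalHessian k n (fun i => W i ω) (fun i => r i ω) a b -
        ∫ ω, deriv (psi k) (r₀ ω) * outer (W₀ ω) a b ∂P) atTop fun _ => 0 := by
  have hmeas : Measurable fun d : EuclideanSpace ℝ ι × ℝ => deriv (psi k) d.2 * outer d.1 a b :=
    ((measurable_deriv _).comp measurable_snd).mul (by unfold outer Matrix.vecMulVec; fun_prop)
  have hint : Integrable (fun ω => deriv (psi k) (r₀ ω) * outer (W₀ ω) a b) P := by
    refine ((hW₀.eval_piLp a).integrable_mul (hW₀.eval_piLp b)).mono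
      (hmeas.comp_aemeasurable (hident 0).aemeasurable_snd).aestronglyMeasurable
      (.of_forall fun ω => ?_)
    rw [norm_mul]
    refine mul_le_of_le_one_left (norm_nonneg _) ?_
    rcases deriv_psi_mem hk (r₀ ω) with h | h <;> simp [h]
  have hlln := tendstoInMeasure_average_sub_integral
    (fun i j hij => (hindep hij).comp hmeas hmeas) (fun i => (hident i).comp hmeas) hint
  simpa [empiricalHessian, Matrix.sum_apply] using hlln

lemma tendstoInMeasure_expansion_remainder [IsFiniteMeasure P] (hk : 0 < k)
    (hindep : Pairwise fun i j => (fun ω => (W i ω, r i ω)) ⟂ᵢ[P] fun ω => (W j ω, r j ω))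
    (hident : ∀ i, IdentDistrib (fun ω => (W i ω, r i ω)) (fun ω => (W₀ ω, r₀ ω)) P P)
    (hW₀ : MemLp W₀ 2 P) (hatom : ∀ᵐ ω ∂P, |r₀ ω| ≠ k) {U : Matrix ι ι ℝ}
    (hU : ∀ a b, U a b = ∫ ω, deriv (psi k) (r₀ ω) * outer (W₀ ω) a b ∂P) (M : ℝ) :
    TendstoInMeasure P (fun (n : ℕ) ω =>
      M ^ 2 * ((n : ℝ)⁻¹ * ∑ i ∈ Finset.range n, kinkMass k M n (W i ω) (r i ω) +
        ∑ a, ∑ b, |(empiricalHessian k n (fun i => W i ω) (fun i => r i ω) - U) a b|))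
      atTop fun _ => 0 := by
  have hcont : Continuous fun v : ι × ι → ℝ => ∑ a, ∑ b, |v (a, b)| :=
    continuous_finsetSum _ fun a _ => continuous_finsetSum _ fun b _ => by fun_prop
  have hhess := tendstoInMeasure_zero_of_continuousAt (P := P) (l := atTop)
    (f := fun (ab : ι × ι) n ω =>
      (empiricalHessian k n (fun i => W i ω) (fun i => r i ω) - U) ab.1 ab.2)
    hcont.continuousAt (by simp) fun ab => by
      simpa only [Matrix.sub_apply, hU]
        using tendstoInMeasure_empiricalHessian_sub hk hindep hident hW₀ ab.1 ab.2
  exact tendstoInMeasure_zero_const_smul _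
    (tendstoInMeasure_zero_add (tendstoInMeasure_average_kinkMass hident hW₀ hatom M) hhess)

lemma memLp_psi_smul (hk : 0 < k) {q : ENNReal} (hW₀ : MemLp W₀ q P) (hr₀ : AEMeasurable r₀ P) :
    MemLp (fun ω => psi k (r₀ ω) • W₀ ω) q P :=
  hW₀.of_le_mul (c := k)
    ((measurable_psi.comp_aemeasurable hr₀).aestronglyMeasurable.smul hW₀.aestronglyMeasurable)
    (.of_forall fun ω => by
      rw [norm_smul]
      exact mul_le_mul_of_nonneg_right (abs_psi_le hk _) (norm_nonneg _))

theorem tendstoInMeasure_huber_linearization [DecidableEq ι] [IsFiniteMeasure P] (hk : 0 < k)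
    (hindep : Pairwise fun i j => (fun ω => (W i ω, r i ω)) ⟂ᵢ[P] fun ω => (W j ω, r j ω))
    (hident : ∀ i, IdentDistrib (fun ω => (W i ω, r i ω)) (fun ω => (W₀ ω, r₀ ω)) P P)
    (hW₀ : MemLp W₀ 2 P) (hatom : ∀ᵐ ω ∂P, |r₀ ω| ≠ k) {U : Matrix ι ι ℝ} (hUpos : U.PosDef)
    (hU : ∀ a b, U a b = ∫ ω, deriv (psi k) (r₀ ω) * outer (W₀ ω) a b ∂P)
    (hscore : ∫ ω, psi k (r₀ ω) • W₀ ω ∂P = 0) {T : ℕ → Ω → EuclideanSpace ℝ ι}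
    (hT : ∀ n, ∀ᵐ ω ∂P, ∀ t, ∑ i ∈ Finset.range n, rho k (r i ω - inner ℝ (W i ω) (T n ω)) ≤
      ∑ i ∈ Finset.range n, rho k (r i ω - inner ℝ (W i ω) t)) :
    TendstoInMeasure P (fun (n : ℕ) ω => √(n : ℝ) • T n ω -
      WithLp.toLp 2 (U⁻¹ *ᵥ (rootSum (fun i ω => psi k (r i ω) • W i ω) n ω :)))
      atTop fun _ => 0 := by
  set z : ℕ → Ω → EuclideanSpace ℝ ι := rootSum fun i ω => psi k (r i ω) • W i ω
  have hz : BoundedInMeasure P z := by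
    have hmeas : Measurable fun d : EuclideanSpace ℝ ι × ℝ => psi k d.2 • d.1 :=
      (measurable_psi.comp measurable_snd).smul measurable_fst
    exact boundedInMeasure_rootSum_euclideanSpace (fun i j hij => (hindep hij).comp hmeas hmeas)
      (fun i => (hident i).comp hmeas)
      (memLp_psi_smul hk hW₀ (measurable_snd.comp_aemeasurable (hident 0).aemeasurable_snd)) hscore
  obtain ⟨c, hc, hcU⟩ := exists_pos_mul_norm_sq_le_of_posDef hUpos
  refine tendstoInMeasure_argmin_sub_of_convexOn
    (A := fun n ω => localObjective k n (fun i => W i ω) fun i => r i ω)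
    (q := fun n ω t => t ⬝ᵥ U *ᵥ t / 2 - z n ω ⬝ᵥ t)
    (R := fun M n ω =>
      M ^ 2 * ((n : ℝ)⁻¹ * ∑ i ∈ Finset.range n, kinkMass k M n (W i ω) (r i ω) +
        ∑ a, ∑ b, |(empiricalHessian k n (fun i => W i ω) (fun i => r i ω) - U) a b|))
    (half_pos hc) (fun n ω => convexOn_localObjective hk n (fun i => W i ω) fun i => r i ω) ?_
    (fun n ω t => ?_)
    (fun M => .of_forall fun n ω t ht => abs_localObjective_sub_quadratic_le hk _ _ U ht)
    (tendstoInMeasure_expansion_remainder hk hindep hident hW₀ hatom hU)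
    (hz.continuousLinearMap_comp (Matrix.toEuclideanCLM (𝕜 := ℝ) U⁻¹))
  · filter_upwards [eventually_gt_atTop 0] with n hn
    filter_upwards [hT n] with ω hω t
    have hsqrt : √(n : ℝ) ≠ 0 := by positivity
    simp only [localObjective, Finset.sum_sub_distrib, inv_smul_smul₀ hsqrt]
    exact sub_le_sub_right (hω _) _
  · have hsymm : U.IsSymm := by simpa using hUpos.isHermitian
    have hcenter : U *ᵥ U⁻¹ *ᵥ z n ω = z n ω := by
      rw [Matrix.mulVec_mulVec, Matrix.mul_nonsing_inv _
        ((Matrix.isUnit_iff_isUnit_det U).1 hUpos.isUnit), Matrix.one_mulVec]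
    have hgrowth := hcU (t - WithLp.toLp 2 (U⁻¹ *ᵥ z n ω))
    rw [WithLp.ofLp_sub] at hgrowth
    beta_reduce
    rw [quadratic_eq_add_of_mulVec_eq hsymm hcenter t]
    linarith

end Linearization

section ConditionalCentering

variable {Ω 𝓧 : Type*} [MeasurableSpace Ω] [MeasurableSpace 𝓧] {P : Measure Ω} [IsFiniteMeasure P]

lemma integral_mul_comp_eq_zero_of_condExp_comap {X : Ω → 𝓧} (hX : Measurable X) {f : Ω → ℝ}
    (hf : Integrable f P) (hcond : P[f | MeasurableSpace.comap X inferInstance] =ᵐ[P] 0)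
    {g : 𝓧 → ℝ} (hg : Measurable g) (hfg : Integrable (fun ω => f ω * g (X ω)) P) :
    ∫ ω, f ω * g (X ω) ∂P = 0 := by
  have hpull := condExp_mul_of_stronglyMeasurable_right
    (hg.comp (comap_measurable X)).stronglyMeasurable hfg hf
  rw [← integral_condExp hX.comap_le]
  refine integral_eq_zero_of_ae (hpull.trans ?_)
  filter_upwards [hcond] with ω hω
  simp [hω]

end ConditionalCentering

section Regressor

variable {Ω : Type*} [MeasurableSpace Ω] {P : Measure Ω} {p : ℕ} {k : ℝ}
  {X : Ω → EuclideanSpace ℝ (Fin p)} {e : Ω → ℝ}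

lemma measurable_design : Measurable (design : EuclideanSpace ℝ (Fin p) → RegIdx p → ℝ) := by
  refine measurable_pi_iff.2 fun a => ?_
  rcases a with _ | j
  · exact measurable_const
  · simp only [design, Sum.elim_inr]
    fun_prop

lemma memLp_design [IsFiniteMeasure P] {q : ENNReal} (hX : MemLp X q P) :
    MemLp (fun ω => WithLp.toLp 2 (design (X ω))) q P := by
  refine memLp_piLp_iff.2 fun a => ?_
  rcases a with _ | j
  · exact memLp_const 1
  · exact hX.eval_piLp j

lemma posSemidef_integral_mul {ι : Type*} [Finite ι] {Y : Ω → ι → ℝ}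
    (h2 : ∀ a, MemLp (fun ω => Y ω a) 2 P) :
    (Matrix.of fun a b => ∫ ω, Y ω a * Y ω b ∂P).PosSemidef := by
  cases nonempty_fintype ι
  refine Matrix.PosSemidef.of_dotProduct_mulVec_nonneg ?_ fun t => ?_
  · ext a b
    simp [mul_comm]
  · have hint (a b : ι) : Integrable (fun ω => t a * (Y ω a * Y ω b * t b)) P :=
      (((h2 a).integrable_mul (h2 b)).mul_const _).const_mul _
    have hsq := calc
      ∫ ω, (t ⬝ᵥ Y ω) ^ 2 ∂P = ∫ ω, ∑ a, ∑ b, t a * (Y ω a * Y ω b * t b) ∂P := by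
          simp only [sq, dotProduct, Finset.sum_mul_sum, mul_assoc, mul_comm (Y _ _) (t _)]
      _ = ∑ a, ∑ b, ∫ ω, t a * (Y ω a * Y ω b * t b) ∂P := by
          rw [integral_finsetSum _ fun a _ => integrable_finsetSum _ fun b _ => hint a b]
          exact Finset.sum_congr rfl fun a _ => integral_finsetSum _ fun b _ => hint a b
      _ = star t ⬝ᵥ (Matrix.of fun a b => ∫ ω, Y ω a * Y ω b ∂P) *ᵥ t := by
          simp only [integral_const_mul, integral_mul_const, dotProduct, Matrix.mulVec,
            Finset.mul_sum, star_trivial, Matrix.of_apply]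
    rw [← hsq]
    exact integral_nonneg fun ω => sq_nonneg _

lemma posSemidef_U11 [IsFiniteMeasure P] (hk : 0 < k) (hX : MemLp X 2 P) (he : AEMeasurable e P) :
    (U11 k X e P).PosSemidef := by
  have hmem (a : RegIdx p) :
      MemLp (fun ω => deriv (psi k) (e ω) * design (X ω) a) 2 P := by
    have hw := (memLp_design hX).eval_piLp a
    refine hw.of_le (((measurable_deriv (psi k)).comp_aemeasurable he).aestronglyMeasurable.mul
      hw.aestronglyMeasurable) (.of_forall fun ω => ?_)
    rcases deriv_psi_mem hk (e ω) with h | h <;> simp [h]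
  convert posSemidef_integral_mul hmem using 1
  ext a b
  refine integral_congr_ae (.of_forall fun ω => ?_)
  rcases deriv_psi_mem hk (e ω) with h | h <;> simp [h, outer, Matrix.vecMulVec_apply]

end Regressor

section Population

variable {Ω : Type*} [MeasurableSpace Ω] {P : Measure Ω} {p : ℕ} {k : ℝ}
  {X : Ω → EuclideanSpace ℝ (Fin p)} {e : Ω → ℝ}

lemma inv_U1 (hU : IsUnit (U11 k X e P)) :
    (U1 k X e P)⁻¹ = Matrix.fromBlocks (U11 k X e P)⁻¹ 0 0 1 := by
  refine Matrix.inv_eq_right_inv ?_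
  rw [U1, Matrix.fromBlocks_one, Matrix.fromBlocks_multiply, Matrix.mul_nonsing_inv _
    ((Matrix.isUnit_iff_isUnit_det _).1 hU)]
  simp

lemma transpose_U11 : (U11 k X e P)ᵀ = U11 k X e P := by
  ext a b
  simp only [Matrix.transpose_apply, U11, Matrix.of_apply, outer, Matrix.vecMulVec_apply, mul_comm]

lemma transpose_inv_U1 : ((U1 k X e P)⁻¹)ᵀ = (U1 k X e P)⁻¹ := by
  rw [Matrix.transpose_nonsing_inv]
  simp [U1, Matrix.fromBlocks_transpose, transpose_U11]

/-- The estimating function of the joint parameter at one observation `(x, ε)`: the Huber score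
`ψ(ε)w`, the deviation of `vech((x - m)(x - m)ᵀ)` from `vech(S)`, and the deviation `x - m`. -/
noncomputable def score (k : ℝ) (m : EuclideanSpace ℝ (Fin p)) (S : Matrix (Fin p) (Fin p) ℝ)
    (d : EuclideanSpace ℝ (Fin p) × ℝ) : EuclideanSpace ℝ (ParamIdx p) :=
  WithLp.toLp 2 (Sum.elim (psi k d.2 • design d.1)
    (Sum.elim (vech (outer fun j => (d.1 - m) j) - vech S) fun j => (d.1 - m) j))

/-- The influence function `U₁⁻¹ · score` of the joint estimator, at the population mean and
covariance. -/
noncomputable def influence (k : ℝ) (X : Ω → EuclideanSpace ℝ (Fin p)) (e : Ω → ℝ)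
    (P : Measure Ω) (d : EuclideanSpace ℝ (Fin p) × ℝ) : EuclideanSpace ℝ (ParamIdx p) :=
  Matrix.toEuclideanCLM (𝕜 := ℝ) (U1 k X e P)⁻¹ (score k (muX X P) (SigmaX X P) d)

lemma measurable_score (k : ℝ) (m : EuclideanSpace ℝ (Fin p)) (S : Matrix (Fin p) (Fin p) ℝ) :
    Measurable (score k m S) := by
  have hpsi := measurable_psi (k := k)
  refine (WithLp.measurable_toLp 2 _).comp (measurable_pi_iff.2 fun a => ?_)
  rcases a with a | ij | j
  · exact (hpsi.comp measurable_snd).mul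
      ((measurable_pi_iff.1 measurable_design a).comp measurable_fst)
  · simp only [Sum.elim_inr, Sum.elim_inl, Pi.sub_apply, vech, outer, Matrix.vecMulVec_apply]
    fun_prop
  · simp only [Sum.elim_inr]
    fun_prop

lemma measurable_influence : Measurable (influence k X e P) :=
  (Matrix.toEuclideanCLM (𝕜 := ℝ) (U1 k X e P)⁻¹).measurable.comp (measurable_score _ _ _)

lemma ofLp_influence (hU : IsUnit (U11 k X e P)) (d : EuclideanSpace ℝ (Fin p) × ℝ) :
    (influence k X e P d).ofLp = Sum.elim ((U11 k X e P)⁻¹ *ᵥ (psi k d.2 • design d.1))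
      (Sum.elim (vech (outer fun j => (d.1 - muX X P) j) - vech (SigmaX X P))
        fun j => (d.1 - muX X P) j) := by
  rw [influence, Matrix.ofLp_toEuclideanCLM, inv_U1 hU, Matrix.fromBlocks_mulVec]
  simp only [score, Matrix.zero_mulVec, Matrix.one_mulVec, add_zero, zero_add]
  rfl

lemma memLp_sub_muX [IsFiniteMeasure P] {q : ENNReal} (hX : MemLp X q P) (j : Fin p) :
    MemLp (fun ω => (X ω - muX X P) j) q P :=
  (hX.sub (memLp_const _)).eval_piLp j

lemma memLp_vechSq [IsFiniteMeasure P] (hX : MemLp X 4 P) (ij : VechIdx p) :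
    MemLp (fun ω => vechSq X P ω ij) 2 P := by
  have : ENNReal.HolderTriple 4 4 2 := ⟨by
    rw [← two_mul, show (4 : ENNReal) = 2 * 2 by norm_num, ENNReal.mul_inv (by simp) (by simp),
      ← mul_assoc, ENNReal.mul_inv_cancel (by simp) (by simp), one_mul]⟩
  exact (memLp_sub_muX hX ij.1.2).mul' (memLp_sub_muX hX ij.1.1)

lemma integral_vechSq (hX : Integrable X P) (ij : VechIdx p) :
    ∫ ω, vechSq X P ω ij ∂P = vech (SigmaX X P) ij := by
  simp only [vechSq, vech, outer, Matrix.vecMulVec_apply, SigmaX, covMat, Matrix.of_apply,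
    covariance, PiLp.sub_apply, muX, eval_integral_piLp hX.eval_piLp]

lemma memLp_score [IsFiniteMeasure P] (hk : 0 < k) (hX : MemLp X 4 P) (he : AEMeasurable e P) :
    MemLp (fun ω => score k (muX X P) (SigmaX X P) (X ω, e ω)) 2 P := by
  have hX2 : MemLp X 2 P := hX.mono_exponent (by norm_num)
  refine memLp_piLp_iff.2 fun a => ?_
  rcases a with a | ij | j
  · exact (memLp_psi_smul hk (memLp_design hX2) he).eval_piLp a
  · exact (memLp_vechSq hX ij).sub (memLp_const _)
  · exact memLp_sub_muX hX2 j

lemma memLp_influence [IsFiniteMeasure P] (hk : 0 < k) (hX : MemLp X 4 P) (he : AEMeasurable e P) :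
    MemLp (fun ω => influence k X e P (X ω, e ω)) 2 P :=
  (Matrix.toEuclideanCLM (𝕜 := ℝ) (U1 k X e P)⁻¹).comp_memLp' (memLp_score hk hX he)

lemma integrable_psi [IsFiniteMeasure P] (hk : 0 < k) (he : AEMeasurable e P) :
    Integrable (fun ω => psi k (e ω)) P :=
  .of_bound (measurable_psi.comp_aemeasurable he).aestronglyMeasurable k
    (.of_forall fun _ => abs_psi_le hk _)

lemma memLp_psi_mul_design [IsFiniteMeasure P] (hk : 0 < k) (hX : MemLp X 2 P)
    (he : AEMeasurable e P) (a : RegIdx p) :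
    MemLp (fun ω => psi k (e ω) * design (X ω) a) 2 P :=
  (memLp_psi_smul hk (memLp_design hX) he).eval_piLp a

lemma integral_psi_mul_design [IsFiniteMeasure P] (hk : 0 < k) (hXm : Measurable X)
    (hX : MemLp X 2 P) (he : AEMeasurable e P)
    (hcond : P[fun ω => psi k (e ω) | MeasurableSpace.comap X inferInstance] =ᵐ[P] 0)
    (a : RegIdx p) : ∫ ω, psi k (e ω) * design (X ω) a ∂P = 0 :=
  integral_mul_comp_eq_zero_of_condExp_comap hXm (integrable_psi hk he) hcond
    (measurable_pi_iff.1 measurable_design a)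
    ((memLp_psi_mul_design hk hX he a).integrable one_le_two)

variable [IsProbabilityMeasure P]

lemma integral_sub_muX (hX : Integrable X P) (j : Fin p) :
    ∫ ω, (X ω - muX X P) j ∂P = 0 := by
  simp only [PiLp.sub_apply]
  rw [integral_sub (hX.eval_piLp j) (integrable_const _), muX, eval_integral_piLp hX.eval_piLp]
  simp

lemma integral_score (hk : 0 < k) (hXm : Measurable X) (hX : MemLp X 4 P) (he : AEMeasurable e P)
    (hcond : P[fun ω => psi k (e ω) | MeasurableSpace.comap X inferInstance] =ᵐ[P] 0) :
    ∫ ω, score k (muX X P) (SigmaX X P) (X ω, e ω) ∂P = 0 := by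
  have hX2 : MemLp X 2 P := hX.mono_exponent (by norm_num)
  have hX1 : Integrable X P := hX2.integrable one_le_two
  ext a
  rw [eval_integral_piLp ((memLp_score hk hX he).integrable one_le_two).eval_piLp]
  rcases a with a | ij | j
  · exact integral_psi_mul_design hk hXm hX2 he hcond a
  · refine (integral_sub ((memLp_vechSq hX ij).integrable one_le_two) (integrable_const _)).trans ?_
    simp [integral_vechSq hX1]
  · exact integral_sub_muX hX1 j

lemma integral_influence (hk : 0 < k) (hXm : Measurable X) (hX : MemLp X 4 P)
    (he : AEMeasurable e P)
    (hcond : P[fun ω => psi k (e ω) | MeasurableSpace.comap X inferInstance] =ᵐ[P] 0) :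
    ∫ ω, influence k X e P (X ω, e ω) ∂P = 0 := by
  simp only [influence]
  rw [ContinuousLinearMap.integral_comp_comm _ ((memLp_score hk hX he).integrable one_le_two),
    integral_score hk hXm hX he hcond, map_zero]

lemma covariance_psi_mul_design (hk : 0 < k) (hXm : Measurable X) (hX : MemLp X 2 P)
    (he : AEMeasurable e P)
    (hcond : P[fun ω => psi k (e ω) | MeasurableSpace.comap X inferInstance] =ᵐ[P] 0)
    (a b : RegIdx p) :
    cov[fun ω => psi k (e ω) * design (X ω) a, fun ω => psi k (e ω) * design (X ω) b; P]
      = V11 k X e P a b := by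
  have hmem := memLp_psi_mul_design hk hX he
  rw [covariance_eq_sub (hmem a) (hmem b), integral_psi_mul_design hk hXm hX he hcond, zero_mul,
    sub_zero]
  refine integral_congr_ae (.of_forall fun ω => ?_)
  simp only [Pi.mul_apply, outer, Matrix.vecMulVec_apply]
  ring

lemma covariance_psi_mul_design_comp (hk : 0 < k) (hXm : Measurable X) (hX : MemLp X 2 P)
    (he : AEMeasurable e P)
    (hcond : P[fun ω => psi k (e ω) | MeasurableSpace.comap X inferInstance] =ᵐ[P] 0)
    (a : RegIdx p) {g : EuclideanSpace ℝ (Fin p) → ℝ} (hg : Measurable g)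
    (hg2 : MemLp (fun ω => g (X ω)) 2 P) :
    cov[fun ω => psi k (e ω) * design (X ω) a, fun ω => g (X ω); P] = 0 := by
  have hmem := memLp_psi_mul_design hk hX he a
  have hprod : ∫ ω, psi k (e ω) * (design (X ω) a * g (X ω)) ∂P = 0 :=
    integral_mul_comp_eq_zero_of_condExp_comap hXm (integrable_psi hk he) hcond
      ((measurable_pi_iff.1 measurable_design a).mul hg) <| by
        simpa only [Pi.mul_def, mul_assoc] using hmem.integrable_mul hg2
  rw [covariance_eq_sub hmem hg2, integral_psi_mul_design hk hXm hX he hcond, zero_mul, sub_zero,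
    ← hprod]
  simp only [Pi.mul_apply, mul_assoc]

lemma covariance_vechSq_sub_muX (hX : MemLp X 4 P) (ij : VechIdx p) (j : Fin p) :
    cov[fun ω => vechSq X P ω ij, fun ω => (X ω - muX X P) j; P] = V23 X P ij j := by
  have hX2 : MemLp X 2 P := hX.mono_exponent (by norm_num)
  rw [covariance_eq_sub (memLp_vechSq hX ij) (memLp_sub_muX hX2 j),
    integral_sub_muX (hX2.integrable one_le_two), mul_zero, sub_zero]
  rfl

lemma covMat_score (hk : 0 < k) (hXm : Measurable X) (hX : MemLp X 4 P) (he : AEMeasurable e P)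
    (hcond : P[fun ω => psi k (e ω) | MeasurableSpace.comap X inferInstance] =ᵐ[P] 0) :
    covMat (fun ω => score k (muX X P) (SigmaX X P) (X ω, e ω)) P = V1 k X e P := by
  have hX2 : MemLp X 2 P := hX.mono_exponent (by norm_num)
  have hv (ij : VechIdx p) := (memLp_vechSq hX ij).integrable one_le_two
  have hc (j : Fin p) := (hX2.integrable one_le_two).eval_piLp j
  have hmeas (b : VechIdx p ⊕ Fin p) : Measurable fun x : EuclideanSpace ℝ (Fin p) =>
      score k (muX X P) (SigmaX X P) (x, 0) (.inr b) :=
    (EuclideanSpace.proj (𝕜 := ℝ) (.inr b)).measurable.comp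
      ((measurable_score k _ _).comp measurable_prodMk_right)
  have hcross (a : RegIdx p) (b : VechIdx p ⊕ Fin p) :
      covMat (fun ω => score k (muX X P) (SigmaX X P) (X ω, e ω)) P (.inl a) (.inr b) = 0 :=
    covariance_psi_mul_design_comp hk hXm hX2 he hcond a (hmeas b)
      ((memLp_score hk hX he).eval_piLp (.inr b))
  have hmixed (ij : VechIdx p) (j : Fin p) :
      covMat (fun ω => score k (muX X P) (SigmaX X P) (X ω, e ω)) P (.inr (.inl ij)) (.inr (.inr j))
        = V23 X P ij j :=
    (covariance_sub_const_left (hv ij) _).trans (covariance_vechSq_sub_muX hX ij j)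
  ext (a | ij | j) (b | ij' | j')
  · exact covariance_psi_mul_design hk hXm hX2 he hcond a b
  · exact hcross a (.inl ij')
  · exact hcross a (.inr j')
  · exact (covariance_comm _ _).trans (hcross b (.inl ij))
  · exact (covariance_sub_const_left (hv ij) _).trans (covariance_sub_const_right (hv ij') _)
  · exact hmixed ij j'
  · exact (covariance_comm _ _).trans (hcross b (.inr j))
  · exact (covariance_comm _ _).trans (hmixed ij' j)
  · exact (covariance_sub_const_left (hc j) _).trans (covariance_sub_const_right (hc j') _)

lemma covMat_influence (hk : 0 < k) (hXm : Measurable X) (hX : MemLp X 4 P)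
    (he : AEMeasurable e P)
    (hcond : P[fun ω => psi k (e ω) | MeasurableSpace.comap X inferInstance] =ᵐ[P] 0) :
    covMat (fun ω => influence k X e P (X ω, e ω)) P
      = (U1 k X e P)⁻¹ * V1 k X e P * (U1 k X e P)⁻¹ := by
  have h := covMat_mulVec (memLp_score hk hX he).eval_piLp (U1 k X e P)⁻¹
  rwa [transpose_inv_U1, covMat_score hk hXm hX he hcond] at h

end Population

section Sample

variable {p : ℕ} {k : ℝ}

lemma inner_design (x : EuclideanSpace ℝ (Fin p)) (t : EuclideanSpace ℝ (RegIdx p)) :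
    inner ℝ (WithLp.toLp 2 (design x)) t =
      t (.inl ()) + inner ℝ x (WithLp.toLp 2 fun j => t (.inr j)) := by
  simp [PiLp.inner_apply, design]

/-- The intercept `m` and the slope `b` as one vector `(m, bᵀ)ᵀ`. -/
def regParam (m : ℝ) (b : EuclideanSpace ℝ (Fin p)) : EuclideanSpace ℝ (RegIdx p) :=
  WithLp.toLp 2 (Sum.elim (fun _ => m) fun j => b j)

lemma inner_design_regParam (x : EuclideanSpace ℝ (Fin p)) (m : ℝ) (b : EuclideanSpace ℝ (Fin p)) :
    inner ℝ (WithLp.toLp 2 (design x)) (regParam m b) = m + inner ℝ x b :=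
  inner_design x (regParam m b)

lemma IsHuberFit.sum_rho_le {n : ℕ} {y ε : ℕ → ℝ} {x : ℕ → EuclideanSpace ℝ (Fin p)}
    {m m₀ : ℝ} {b b₀ : EuclideanSpace ℝ (Fin p)} (h : IsHuberFit k n y x m b)
    (hy : ∀ i, y i = m₀ + inner ℝ (x i) b₀ + ε i) (t : EuclideanSpace ℝ (RegIdx p)) :
    ∑ i ∈ Finset.range n,
        rho k (ε i - inner ℝ (WithLp.toLp 2 (design (x i))) (regParam (m - m₀) (b - b₀)))
      ≤ ∑ i ∈ Finset.range n, rho k (ε i - inner ℝ (WithLp.toLp 2 (design (x i))) t) := by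
  convert h (m₀ + t (.inl ())) (b₀ + WithLp.toLp 2 fun j => t (.inr j)) using 1
  · refine Finset.sum_congr rfl fun i _ => congrArg (rho k) ?_
    rw [inner_design_regParam, inner_sub_right, hy]
    ring
  · refine Finset.sum_congr rfl fun i _ => congrArg (rho k) ?_
    rw [inner_design, inner_add_right, hy]
    ring

lemma sampleMean_apply (n : ℕ) (x : ℕ → EuclideanSpace ℝ (Fin p)) (j : Fin p) :
    sampleMean n x j = (n : ℝ)⁻¹ * ∑ i ∈ Finset.range n, x i j := by
  simp [sampleMean]

lemma sampleCov_apply (n : ℕ) (x : ℕ → EuclideanSpace ℝ (Fin p)) (j l : Fin p) :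
    sampleCov n x j l = (n : ℝ)⁻¹ * ∑ i ∈ Finset.range n,
      (x i j - sampleMean n x j) * (x i l - sampleMean n x l) := by
  simp [sampleCov, outer, Matrix.sum_apply, Matrix.vecMulVec_apply]

end Sample

section AsymptoticLinearity

variable {Ω : Type*} [MeasurableSpace Ω] {P : Measure Ω} {p : ℕ} {k : ℝ}
  {X : Ω → EuclideanSpace ℝ (Fin p)} {e : Ω → ℝ}
  {x : ℕ → Ω → EuclideanSpace ℝ (Fin p)} {eps y : ℕ → Ω → ℝ}

lemma rootSum_influence_inl (hU : IsUnit (U11 k X e P)) (n : ℕ) (ω : Ω) (a : RegIdx p) :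
    rootSum (fun i ω => influence k X e P (x i ω, eps i ω)) n ω (.inl a) =
      ((U11 k X e P)⁻¹ *ᵥ
        (rootSum (fun i ω => psi k (eps i ω) • WithLp.toLp 2 (design (x i ω))) n ω :)) a := by
  simp only [ofLp_rootSum, ofLp_influence hU, Sum.elim_inl]
  simp only [rootSum, WithLp.ofLp_smul, WithLp.ofLp_sum, Matrix.mulVec_smul, Matrix.mulVec_sum,
    Pi.smul_apply, Finset.sum_apply]

lemma rootSum_influence_inr_inr (hU : IsUnit (U11 k X e P)) (n : ℕ) (ω : Ω) (j : Fin p) :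
    rootSum (fun i ω => influence k X e P (x i ω, eps i ω)) n ω (.inr (.inr j)) =
      √(n : ℝ) * (sampleMean n (fun i => x i ω) - muX X P) j := by
  rw [ofLp_rootSum]
  simp only [ofLp_influence hU, Sum.elim_inr]
  rw [← ofLp_rootSum (fun i ω => x i ω - muX X P), ← sqrt_smul_average_sub]
  rfl

lemma aemeasurable_joint {mHat : Ω → ℝ} {bHat : Ω → EuclideanSpace ℝ (Fin p)}
    (hm : AEMeasurable mHat P) (hb : AEMeasurable bHat P) (hx : ∀ i, AEMeasurable (x i) P) (n : ℕ) :
    AEMeasurable (fun ω => joint (mHat ω) (bHat ω) (sampleCov n fun i => x i ω)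
      (sampleMean n fun i => x i ω)) P := by
  refine (WithLp.measurable_toLp 2 _).comp_aemeasurable (aemeasurable_pi_iff.2 fun a => ?_)
  rcases a with (_ | j) | ij | j
  · exact hm
  · simp only [Sum.elim_inl, Sum.elim_inr]
    fun_prop
  · simp only [Sum.elim_inl, Sum.elim_inr, vech, sampleCov_apply, sampleMean_apply]
    fun_prop
  · simp only [Sum.elim_inr, sampleMean_apply]
    fun_prop

variable [IsProbabilityMeasure P]

lemma tendstoInMeasure_huberFit_sub (hk : 0 < k) {m : ℝ} {b : EuclideanSpace ℝ (Fin p)}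
    (hy : ∀ i ω, y i ω = m + inner ℝ (x i ω) b + eps i ω)
    (hindep : Pairwise fun i j => (fun ω => (x i ω, eps i ω)) ⟂ᵢ[P] fun ω => (x j ω, eps j ω))
    (hident : ∀ i, IdentDistrib (fun ω => (x i ω, eps i ω)) (fun ω => (X ω, e ω)) P P)
    (hXm : Measurable X) (hX : MemLp X 2 P)
    (hcond : P[fun ω => psi k (e ω) | MeasurableSpace.comap X inferInstance] =ᵐ[P] 0)
    (hatom : ∀ᵐ ω ∂P, |e ω| ≠ k) (hU : IsUnit (U11 k X e P))
    {mHat : ℕ → Ω → ℝ} {bHat : ℕ → Ω → EuclideanSpace ℝ (Fin p)}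
    (hfit : ∀ n, ∀ᵐ ω ∂P,
      IsHuberFit k n (fun i => y i ω) (fun i => x i ω) (mHat n ω) (bHat n ω)) :
    TendstoInMeasure P (fun (n : ℕ) ω => √(n : ℝ) • regParam (mHat n ω - m) (bHat n ω - b) -
      WithLp.toLp 2 ((U11 k X e P)⁻¹ *ᵥ
        (rootSum (fun i ω => psi k (eps i ω) • WithLp.toLp 2 (design (x i ω))) n ω :)))
      atTop fun _ => 0 := by
  have he : AEMeasurable e P := measurable_snd.comp_aemeasurable (hident 0).aemeasurable_snd
  have hW := memLp_design hX
  have hpair : Measurable fun d : EuclideanSpace ℝ (Fin p) × ℝ =>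
      (WithLp.toLp 2 (design d.1), d.2) :=
    ((WithLp.measurable_toLp 2 _).comp (measurable_design.comp measurable_fst)).prodMk
      measurable_snd
  have hscore : ∫ ω, psi k (e ω) • WithLp.toLp 2 (design (X ω)) ∂P = 0 := by
    ext a
    rw [eval_integral_piLp ((memLp_psi_smul hk hW he).integrable one_le_two).eval_piLp]
    exact integral_psi_mul_design hk hXm hX he hcond a
  exact tendstoInMeasure_huber_linearization hk (fun i j hij => (hindep hij).comp hpair hpair)
    (fun i => (hident i).comp hpair) hW hatom ((posSemidef_U11 hk hX he).posDef_iff_isUnit.2 hU)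
    (fun _ _ => rfl) hscore fun n => (hfit n).mono fun ω hω => hω.sum_rho_le fun i => hy i ω

lemma tendstoInMeasure_sampleCov_sub (hindep : Pairwise fun i j => x i ⟂ᵢ[P] x j)
    (hident : ∀ i, IdentDistrib (x i) X P P) (hX : MemLp X 2 P) (s : ℝ) (j l : Fin p) :
    TendstoInMeasure P (fun (n : ℕ) ω => √(n : ℝ) * (sampleCov n (fun i => x i ω) j l - s) -
      rootSum (fun i ω => (x i ω - muX X P) j * (x i ω - muX X P) l - s) n ω)
      atTop fun _ => 0 := by
  have hsum (j : Fin p) : BoundedInMeasure P (rootSum fun i ω => (x i ω - muX X P) j) := by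
    have hcoord : Measurable fun v : EuclideanSpace ℝ (Fin p) => (v - muX X P) j := by fun_prop
    exact boundedInMeasure_rootSum (fun i i' hi => (hindep hi).comp hcoord hcoord)
      (fun i => (hident i).comp hcoord) (memLp_sub_muX hX j)
      (integral_sub_muX (hX.integrable one_le_two) j)
  have hsqrt : Tendsto (fun n : ℕ => -(√(n : ℝ))⁻¹) atTop (𝓝 0) := by
    simpa using (tendsto_inv_atTop_zero.comp
      (Real.tendsto_sqrt_atTop.comp tendsto_natCast_atTop_atTop)).neg
  convert ((hsum j).mul (hsum l)).tendstoInMeasure_smul hsqrt using 3 with n ω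
  simp only [sampleCov_apply, sampleMean_apply, PiLp.sub_apply, smul_eq_mul]
  rw [sqrt_mul_average_mul_sub_average_sub (fun i ω => x i ω j) (fun i ω => x i ω l)
    (muX X P j) (muX X P l)]
  ring

theorem tendstoInMeasure_joint_sub_rootSum_influence (hk : 0 < k) {m : ℝ}
    {b : EuclideanSpace ℝ (Fin p)} (hy : ∀ i ω, y i ω = m + inner ℝ (x i ω) b + eps i ω)
    (hindep : Pairwise fun i j => (fun ω => (x i ω, eps i ω)) ⟂ᵢ[P] fun ω => (x j ω, eps j ω))
    (hident : ∀ i, IdentDistrib (fun ω => (x i ω, eps i ω)) (fun ω => (X ω, e ω)) P P)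
    (hXm : Measurable X) (hX : MemLp X 2 P)
    (hcond : P[fun ω => psi k (e ω) | MeasurableSpace.comap X inferInstance] =ᵐ[P] 0)
    (hatom : ∀ᵐ ω ∂P, |e ω| ≠ k) (hU : IsUnit (U11 k X e P))
    {mHat : ℕ → Ω → ℝ} {bHat : ℕ → Ω → EuclideanSpace ℝ (Fin p)}
    (hfit : ∀ n, ∀ᵐ ω ∂P,
      IsHuberFit k n (fun i => y i ω) (fun i => x i ω) (mHat n ω) (bHat n ω)) :
    TendstoInMeasure P (fun (n : ℕ) ω =>
      √(n : ℝ) • (joint (mHat n ω) (bHat n ω) (sampleCov n fun i => x i ω)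
        (sampleMean n fun i => x i ω) - joint m b (SigmaX X P) (muX X P)) -
      rootSum (fun i ω => influence k X e P (x i ω, eps i ω)) n ω) atTop fun _ => 0 := by
  refine tendstoInMeasure_zero_of_coord fun a => ?_
  rcases a with a | ij | j
  · refine tendstoInMeasure_zero_of_norm_le (tendstoInMeasure_huberFit_sub hk hy hindep hident hXm
      hX hcond hatom hU hfit) (.of_forall fun n => .of_forall fun ω => ?_)
    refine le_of_eq_of_le ?_ (PiLp.norm_apply_le _ a)
    rw [PiLp.sub_apply, rootSum_influence_inl hU]
    rcases a with _ | j <;> rfl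
  · convert tendstoInMeasure_sampleCov_sub
      (fun i j hij => (hindep hij).comp measurable_fst measurable_fst)
      (fun i => (hident i).comp measurable_fst) hX (SigmaX X P ij.1.1 ij.1.2) ij.1.1 ij.1.2
      using 3 with n ω
    rw [PiLp.sub_apply, ofLp_rootSum]
    simp only [ofLp_influence hU]
    rfl
  · have hzero : TendstoInMeasure P (fun (_ : ℕ) (_ : Ω) => (0 : ℝ)) atTop fun _ => 0 :=
      tendstoInMeasure_zero_iff.2 fun δ hδ => by simp [not_le.2 hδ]
    exact hzero.congr_left fun n => .of_forall fun ω =>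
      (sub_eq_zero.2 (rootSum_influence_inr_inr hU n ω j).symm).symm

end AsymptoticLinearity

end HuberReg

theorem theorem1 {Ω : Type*} [MeasurableSpace Ω] (P : Measure Ω) [IsProbabilityMeasure P]
    (p : ℕ) (k : ℝ) (hk : 0 < k)
    (muStar : ℝ) (betaStar : EuclideanSpace ℝ (Fin p))
    -- the generic pair `(x, ε)`
    (X : Ω → EuclideanSpace ℝ (Fin p)) (e : Ω → ℝ) (hX : Measurable X) (he : Measurable e)
    -- the sample
    (x : ℕ → Ω → EuclideanSpace ℝ (Fin p)) (eps y : ℕ → Ω → ℝ)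
    (hx : ∀ i, Measurable (x i)) (heps : ∀ i, Measurable (eps i))
    (hy : ∀ i ω, y i ω = muStar + inner ℝ (x i ω) betaStar + eps i ω)
    (hindep : iIndepFun (fun i ω => (x i ω, eps i ω)) P)
    (hident : ∀ i, IdentDistrib (fun ω => (x i ω, eps i ω)) (fun ω => (X ω, e ω)) P P)
    -- `E[ψ(ε) | x] = 0`
    (hcond : P[fun ω => HuberReg.psi k (e ω) | MeasurableSpace.comap X inferInstance] =ᵐ[P] 0)
    -- `x` has finite fourth moments and a positive definite covariance matrix
    (hmom : Integrable (fun ω => ‖X ω‖ ^ 4) P)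
    (hpos : (HuberReg.SigmaX X P).PosDef)
    -- `ψ'(ε)` exists almost surely, and `E[ψ'(ε) w wᵀ]` is nonsingular
    (hatom : ∀ᵐ ω ∂P, |e ω| ≠ k)
    (hU : IsUnit (HuberReg.U11 k X e P))
    -- the Huber fit
    (muHat : ℕ → Ω → ℝ) (betaHat : ℕ → Ω → EuclideanSpace ℝ (Fin p))
    (hmuHat : ∀ n, AEMeasurable (muHat n) P) (hbetaHat : ∀ n, AEMeasurable (betaHat n) P)
    (hfit : ∀ n, ∀ᵐ ω ∂P, HuberReg.IsHuberFit k n (fun i => y i ω) (fun i => x i ω)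
      (muHat n ω) (betaHat n ω)) :
    ((HuberReg.U1 k X e P)⁻¹ * HuberReg.V1 k X e P * (HuberReg.U1 k X e P)⁻¹).PosSemidef ∧
    TendstoInDistribution
      (fun (n : ℕ) ω => √(n : ℝ) •
        (HuberReg.joint (muHat n ω) (betaHat n ω)
            (HuberReg.sampleCov n fun i => x i ω) (HuberReg.sampleMean n fun i => x i ω)
          - HuberReg.joint muStar betaStar (HuberReg.SigmaX X P) (HuberReg.muX X P)))
      atTop
      (id : EuclideanSpace ℝ (HuberReg.ParamIdx p) → EuclideanSpace ℝ (HuberReg.ParamIdx p))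
      (fun _ => P)
      (multivariateGaussian 0
        ((HuberReg.U1 k X e P)⁻¹ * HuberReg.V1 k X e P * (HuberReg.U1 k X e P)⁻¹)) := by
  have hX4 : MemLp X 4 P := by
    rw [← integrable_norm_rpow_iff hX.aestronglyMeasurable (by norm_num) (by norm_num)]
    exact_mod_cast hmom
  have hX2 : MemLp X 2 P := hX4.mono_exponent (by norm_num)
  have hinfl : MemLp (fun ω => HuberReg.influence k X e P (X ω, e ω)) 2 P :=
    HuberReg.memLp_influence hk hX4 he.aemeasurable
  have hclt := HuberReg.tendstoInDistribution_rootSum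
    (hindep.comp (fun _ => HuberReg.influence k X e P) fun _ => HuberReg.measurable_influence)
    (fun i => (hident i).comp HuberReg.measurable_influence) hinfl
    (HuberReg.integral_influence hk hX hX4 he.aemeasurable hcond)
  have hlin := HuberReg.tendstoInMeasure_joint_sub_rootSum_influence hk hy
    (fun i j hij => hindep.indepFun hij) hident hX hX2 hcond hatom hU hfit
  rw [← HuberReg.covMat_influence hk hX hX4 he.aemeasurable hcond]
  refine ⟨HuberReg.posSemidef_covMat hinfl.eval_piLp, ?_⟩
  refine tendstoInDistribution_of_tendstoInMeasure_sub _ _ hclt hlin fun n => ?_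
  exact ((HuberReg.aemeasurable_joint (hmuHat n) (hbetaHat n) (fun i => (hx i).aemeasurable) n).sub
    aemeasurable_const).fun_const_smul _
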